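/- **Setting.** Let $a\in C^\infty[0,1]$ be real valued with $a(x)\ge a_0>0$ on $[0,1]$, let $\varphi_0,\varphi_1\in\mathbb C$, and for $\varepsilon>0$ let $\varphi\in C^2[0,1]$ be the solution of $$\varepsilon^2\varphi''+a\varphi=0\ \text{ on }(0,1),\qquad \varphi(0)=\varphi_0,\quad \varepsilon\varphi'(0)=\varphi_1 .$$ Put $$b:=-\frac{1}{2a^{1/4}}\big(a^{-1/4}\big)'',\qquad \phi(x):=\int_0^x\big(\sqrt{a(\tau)}-\varepsilon^2b(\tau)\big)\,d\tau,\qquad \mathbf P:=\frac1{\sqrt2}\begin{pmatrix} i&1\\1&i\end{pmatrix},$$ $$U:=\Big(a^{1/4}\varphi,\ \frac{\varepsilon(a^{1/4}\varphi)'}{\sqrt a}\Big)^{\top},\qquad Z(x):=\mathrm{diag}\big(e^{-\frac i\varepsilon\phi(x)},e^{\frac i\varepsilon\phi(x)}\big)\,\mathbf P\,U(x).$$ **Coefficients.** Set $b_0:=\frac{b}{2\phi'}$, $b_p:=\frac{b_{p-1}'}{2\phi'}$ for $p\ge1$, and $$c_0:=\tfrac{b^2b_0}{2\phi'},\ c_1:=\tfrac{c_0'}{2\phi'},\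 d_0:=\tfrac{c_0}{2\phi'},\ d_1:=\tfrac{d_0'}{2\phi'},\ e_0:=\tfrac{c_1}{2\phi'},\ f_0:=\tfrac{b_0}{2\phi'},\ f_1:=\tfrac{f_0'}{2\phi'},\ g_0:=\tfrac{b_1}{2\phi'},\ \kappa_0:=\tfrac{bb_1}{2\phi'},\ l_0:=\tfrac{bb_0b_1}{2\phi'} .$$ Let $h_p(x):=e^{ix}-\sum_{k=0}^{p-1}\frac{(ix)^k}{k!}$ and $Q_S[f](\eta,\xi):=\frac{\eta-\xi}{6}\big(f(\xi)+4f(\frac{\xi+\eta}2)+f(\eta)\big)$. **Schemes.** Let $N\ge1$ be an integer, $h=1/N$, $x_n=nh$ for $n=0,\dots,N$. For a step from $\xi=x_n$ to $\eta=x_{n+1}$ write $s:=\phi(\eta)-\phi(\xi)$, $\sigma:=\frac{2}{\varepsilon}s$, $E(x):=e^{\frac{2i}{\varepsilon}\phi(x)}$, and define for $P=2,3$ $$Q_1^P:=-\sum_{p=1}^P(i\varepsilon)^p\big(b_{p-1}(\eta)E(\eta)-b_{p-1}(\xi)E(\xi)\big)-E(\xi)\sum_{p=1}^P(i\varepsilon)^{p+P}b_{p+P-1}(\eta)\,h_p(\sigma),$$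 $$Q_2^2:=-i\varepsilon(\eta-\xi)\frac{b(\eta)b_0(\eta)+b(\xi)b_0(\xi)}2-\varepsilon^2b_0(\xi)b_0(\eta)h_1(-\sigma)+i\varepsilon^3b_1(\eta)\,[b_0(\xi)-b_0(\eta)]\,h_2(-\sigma),$$ $$\begin{aligned}Q_2^3:=&-i\varepsilon Q_S[bb_0](\eta,\xi)-\varepsilon^2\Big[b_0(\xi)E(\xi)\big(b_0(\eta)E(\eta)^{-1}-b_0(\xi)E(\xi)^{-1}\big)-Q_S[bb_1](\eta,\xi)\Big]\\&+i\varepsilon^3[b_0(\xi)b_1(\eta)-b_1(\xi)b_0(\eta)]\,h_1(-\sigma)\\&+\varepsilon^4\big[(b_0(\xi)+b_0(\eta))b_2(\eta)-b_1(\xi)b_1(\eta)-2b_0(\eta)b_3(\eta)s\big]\,h_2(-\sigma)\\&+i\varepsilon^5\big[(b_0(\eta)-b_0(\xi))b_3(\eta)-(b_1(\eta)-b_1(\xi))b_2(\eta)\big]\,h_3(-\sigma),\end{aligned}$$ $$\begin{aligned}Q_3^3:=&-\varepsilon^2E(\xi)\,\tfrac{\eta-\xi}2\,[c_0(\eta)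+b(\xi)b_0(\xi)b_0(\eta)]\,h_1(\sigma)\\&-i\varepsilon^3E(\xi)\Big[\tfrac12\big[c_1(\eta)(\eta-\xi)+d_0(\eta)+b(\xi)b_0(\xi)\big(b_1(\eta)(\eta-\xi)+f_0(\eta)\big)\big]\\&\qquad+b_0(\xi)b_0(\eta)^2+2s\big(l_0(\eta)-b_0(\xi)\kappa_0(\eta)\big)\Big]h_2(\sigma)\\&+\varepsilon^4E(\xi)\Big[\tfrac12\big[e_0(\eta)+d_1(\eta)+b(\xi)b_0(\xi)\big(g_0(\eta)+f_1(\eta)\big)\big]\\&\qquad+2\big[b_0(\xi)b_0(\eta)b_1(\eta)+l_0(\eta)-b_0(\xi)\kappa_0(\eta)\big]\Big]h_3(\sigma).\end{aligned}$$ With $$\mathbf A_n^{1,P}:=\varepsilon\begin{pmatrix}0&\overline{Q_1^P}\\Q_1^P&0\end{pmatrix},\qquad \mathbf A_n^{2,P}:=\varepsilon^2\begin{pmatrix}Q_2^P&0\\0&\overline{Q_2^P}\end{pmatrix},\qquad \mathbf A_n^{3,3}:=\varepsilon^3\begin{pmatrix}0&\overline{Q_3^3}\\Q_3^3&0\end{pmatrix},$$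 the schemes WKB2 ($P=2$) and WKB3 ($P=3$) are $$Z_0:=\mathbf P\,U(0),\qquad Z_{n+1}:=\Big(\mathbf I+\sum_{p=1}^P\mathbf A_n^{p,P}\Big)Z_n,\qquad n=0,\dots,N-1 .$$ **Phase quadrature.** A numerical integration method is a family of linear rules $I_{N,n}$ acting on functions; it has order $\gamma>0$ if for every $f\in C^\infty[0,1]$ there is a constant $K_f$ with $\big|I_{N,n}(f)-\int_0^{n/N}f\big|\le K_f\,h^\gamma$ for all $N\ge1$, $h=1/N$, and $0\le n\le N$. Fix such a method of order $\gamma$, let $\phi_n:=I_{N,n}(\phi')$, and put $U_n:=\mathbf P^{-1}\,\mathrm{diag}\big(e^{\frac i\varepsilon\phi_n},e^{-\frac i\varepsilon\phi_n}\big)Z_n$. (The exact phase $\phi$ is used in computing $Z_n$.) **Theorem.** Let $0<\varepsilon_0\le1$ be such that $\phi'(x)=\sqrt{a(x)}-\varepsilon^2b(x)\ne0$ for all $x\in[0,1]$ and all $0<\varepsilon\le\varepsilon_0$, and let $\|\cdot\|$ be any norm on $\mathbb C^2$. Then there is a constant $C$, independent of $n$, $h$ and $\varepsilon$, such that for all $0<\varepsilon\le\varepsilon_0$,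 all $N\ge1$ with $h=1/N$, and all $n=0,\dots,N$: for WKB2, $$\|Z_n-Z(x_n)\|\le C\varepsilon^3h^2,\qquad \|U_n-U(x_n)\|\le C\frac{h^\gamma}\varepsilon+C\varepsilon^3h^2,$$ and for WKB3, $$\|Z_n-Z(x_n)\|\le C\varepsilon^3h^3\max(\varepsilon,h),\qquad \|U_n-U(x_n)\|\le C\frac{h^\gamma}\varepsilon+C\varepsilon^3h^3\max(\varepsilon,h).$$ -/

import Mathlib

open scoped ContDiff Matrix

noncomputable section

namespace WKB

/-- The derivative on the closed interval `[0, 1]` (one-sided at the end points). -/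
def D {F : Type*} [NormedAddCommGroup F] [NormedSpace ℝ F] (f : ℝ → F) (x : ℝ) : F :=
  derivWithin f (Set.Icc 0 1) x

/-- `φ` is a classical solution on `[0, 1]` of the initial value problem
`ε² φ'' + a φ = 0`, `φ(0) = φ₀`, `ε φ'(0) = φ₁`. -/
structure IsSolution (a : ℝ → ℝ) (ε : ℝ) (φ₀ φ₁ : ℂ) (φ : ℝ → ℂ) : Prop where
  contDiffOn : ContDiffOn ℝ 2 φ (Set.Icc 0 1)
  ode : ∀ x ∈ Set.Ioo (0 : ℝ) 1, (ε : ℂ) ^ 2 * D (D φ) x + (a x : ℂ) * φ x = 0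
  initial_value : φ 0 = φ₀
  initial_deriv : (ε : ℂ) * D φ 0 = φ₁

/-! ### The WKB transformation -/

/-- `b = -(1 / (2 a^{1/4})) (a^{-1/4})''`. -/
def b (a : ℝ → ℝ) (x : ℝ) : ℝ :=
  -(1 / (2 * a x ^ (1 / 4 : ℝ))) * D (D fun y => a y ^ (-(1 / 4) : ℝ)) x

/-- The derivative `φ' = √a - ε² b` of the phase function. -/
def phaseDeriv (a : ℝ → ℝ) (ε x : ℝ) : ℝ :=
  √(a x) - ε ^ 2 * b a x

/-- The phase function `φ(x) = ∫₀ˣ (√a - ε² b)`. -/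
def phase (a : ℝ → ℝ) (ε x : ℝ) : ℝ :=
  ∫ τ in (0 : ℝ)..x, phaseDeriv a ε τ

/-- The vector `U(x)` attached to a function `φ`. -/
def exactU (a : ℝ → ℝ) (ε : ℝ) (φ : ℝ → ℂ) (x : ℝ) : Fin 2 → ℂ :=
  ![((a x ^ (1 / 4 : ℝ) : ℝ) : ℂ) * φ x,
    (ε : ℂ) * D (fun y => ((a y ^ (1 / 4 : ℝ) : ℝ) : ℂ) * φ y) x / ((√(a x) : ℝ) : ℂ)]

/-- The matrix `P`. -/
def P : Matrix (Fin 2) (Fin 2) ℂ :=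
  ((1 / √2 : ℝ) : ℂ) • !![Complex.I, 1; 1, Complex.I]

/-- The inverse matrix `P⁻¹`. -/
def Pinv : Matrix (Fin 2) (Fin 2) ℂ :=
  ((1 / √2 : ℝ) : ℂ) • !![-Complex.I, 1; 1, -Complex.I]

/-- `exp((i/ε) diag(t, -t))`. -/
def expPhase (ε t : ℝ) : Matrix (Fin 2) (Fin 2) ℂ :=
  Matrix.diagonal ![Complex.exp (Complex.I / ε * t), Complex.exp (-(Complex.I / ε * t))]

/-- `Z(x) = exp(-(i/ε) Φ(x)) P U(x)`. -/
def exactZ (a : ℝ → ℝ) (ε : ℝ) (φ : ℝ → ℂ) (x : ℝ) : Fin 2 → ℂ :=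
  expPhase ε (-phase a ε x) *ᵥ (P *ᵥ exactU a ε φ x)

/-! ### The coefficient functions of the schemes -/

/-- `b₀ = b / (2 φ')` and `b_{p+1} = b_p' / (2 φ')`. -/
def bc (a : ℝ → ℝ) (ε : ℝ) : ℕ → ℝ → ℝ
  | 0 => fun x => b a x / (2 * phaseDeriv a ε x)
  | p + 1 => fun x => D (bc a ε p) x / (2 * phaseDeriv a ε x)

def c0 (a : ℝ → ℝ) (ε x : ℝ) : ℝ := b a x ^ 2 * bc a ε 0 x / (2 * phaseDeriv a ε x)

def c1 (a : ℝ → ℝ) (ε x : ℝ) : ℝ := D (c0 a ε) x / (2 * phaseDeriv a ε x)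

def d0 (a : ℝ → ℝ) (ε x : ℝ) : ℝ := c0 a ε x / (2 * phaseDeriv a ε x)

def d1 (a : ℝ → ℝ) (ε x : ℝ) : ℝ := D (d0 a ε) x / (2 * phaseDeriv a ε x)

def e0 (a : ℝ → ℝ) (ε x : ℝ) : ℝ := c1 a ε x / (2 * phaseDeriv a ε x)

def f0 (a : ℝ → ℝ) (ε x : ℝ) : ℝ := bc a ε 0 x / (2 * phaseDeriv a ε x)

def f1 (a : ℝ → ℝ) (ε x : ℝ) : ℝ := D (f0 a ε) x / (2 * phaseDeriv a ε x)

def g0 (a : ℝ → ℝ) (ε x : ℝ) : ℝ := bc a ε 1 x / (2 * phaseDeriv a ε x)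

def κ0 (a : ℝ → ℝ) (ε x : ℝ) : ℝ := b a x * bc a ε 1 x / (2 * phaseDeriv a ε x)

def l0 (a : ℝ → ℝ) (ε x : ℝ) : ℝ :=
  b a x * bc a ε 0 x * bc a ε 1 x / (2 * phaseDeriv a ε x)

/-- `h_p(x) = e^{ix} - ∑_{k < p} (ix)^k / k!`. -/
def hfun (p : ℕ) (x : ℝ) : ℂ :=
  Complex.exp (Complex.I * x) - ∑ k ∈ Finset.range p, (Complex.I * x) ^ k / (k.factorial : ℂ)

/-- Simpson's rule on the interval from `ξ` to `η`. -/
def simpson (f : ℝ → ℝ) (η ξ : ℝ) : ℝ :=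
  (η - ξ) / 6 * (f ξ + 4 * f ((ξ + η) / 2) + f η)

/-- The phase increment `s = φ(η) - φ(ξ)`. -/
def s (a : ℝ → ℝ) (ε η ξ : ℝ) : ℝ := phase a ε η - phase a ε ξ

/-- The oscillatory factor `e^{(2i/ε) φ(x)}`. -/
def osc (a : ℝ → ℝ) (ε x : ℝ) : ℂ := Complex.exp (2 * Complex.I / ε * phase a ε x)

/-- The quantity `Q₁^P(η, ξ)`. -/
def Q1 (a : ℝ → ℝ) (ε : ℝ) (P : ℕ) (η ξ : ℝ) : ℂ :=
  -(∑ p ∈ Finset.Icc 1 P, (Complex.I * ε) ^ p *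
      (bc a ε (p - 1) η * osc a ε η - bc a ε (p - 1) ξ * osc a ε ξ))
  - osc a ε ξ * ∑ p ∈ Finset.Icc 1 P, (Complex.I * ε) ^ (p + P) * bc a ε (p + P - 1) η *
      hfun p (2 / ε * s a ε η ξ)

/-- The quantity `Q₂²(η, ξ)`. -/
def Q22 (a : ℝ → ℝ) (ε η ξ : ℝ) : ℂ :=
  -(Complex.I * ε) * (η - ξ) * ((b a η * bc a ε 0 η + b a ξ * bc a ε 0 ξ) / 2)
  - (ε : ℂ) ^ 2 * bc a ε 0 ξ * bc a ε 0 η * hfun 1 (-(2 / ε) * s a ε η ξ)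
  + Complex.I * (ε : ℂ) ^ 3 * bc a ε 1 η * (bc a ε 0 ξ - bc a ε 0 η) *
      hfun 2 (-(2 / ε) * s a ε η ξ)

/-- The quantity `Q₂³(η, ξ)`; the factor `e^{-(2i/ε) φ(x)}` is written as `(osc a ε x)⁻¹`. -/
def Q23 (a : ℝ → ℝ) (ε η ξ : ℝ) : ℂ :=
  -(Complex.I * ε) * simpson (fun y => b a y * bc a ε 0 y) η ξ
  - (ε : ℂ) ^ 2 *
      (bc a ε 0 ξ * osc a ε ξ * (bc a ε 0 η * (osc a ε η)⁻¹ - bc a ε 0 ξ * (osc a ε ξ)⁻¹)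
        - simpson (fun y => b a y * bc a ε 1 y) η ξ)
  + Complex.I * (ε : ℂ) ^ 3 * (bc a ε 0 ξ * bc a ε 1 η - bc a ε 1 ξ * bc a ε 0 η) *
      hfun 1 (-(2 / ε) * s a ε η ξ)
  + (ε : ℂ) ^ 4 *
      ((bc a ε 0 ξ + bc a ε 0 η) * bc a ε 2 η - bc a ε 1 ξ * bc a ε 1 η
        - 2 * bc a ε 0 η * bc a ε 3 η * s a ε η ξ) *
      hfun 2 (-(2 / ε) * s a ε η ξ)
  + Complex.I * (ε : ℂ) ^ 5 *
      ((bc a ε 0 η - bc a ε 0 ξ) * bc a ε 3 η - (bc a ε 1 η - bc a ε 1 ξ) * bc a ε 2 η) *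
      hfun 3 (-(2 / ε) * s a ε η ξ)

/-- The quantity `Q₃³(η, ξ)`. -/
def Q33 (a : ℝ → ℝ) (ε η ξ : ℝ) : ℂ :=
  -(ε : ℂ) ^ 2 * osc a ε ξ *
      ((η - ξ) / 2 * (c0 a ε η + b a ξ * bc a ε 0 ξ * bc a ε 0 η)) *
      hfun 1 (2 / ε * s a ε η ξ)
  - Complex.I * (ε : ℂ) ^ 3 * osc a ε ξ *
      (1 / 2 * (c1 a ε η * (η - ξ) + d0 a ε η
          + b a ξ * bc a ε 0 ξ * (bc a ε 1 η * (η - ξ) + f0 a ε η))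
        + (bc a ε 0 ξ * bc a ε 0 η ^ 2
          + 2 * s a ε η ξ * (l0 a ε η - bc a ε 0 ξ * κ0 a ε η))) *
      hfun 2 (2 / ε * s a ε η ξ)
  + (ε : ℂ) ^ 4 * osc a ε ξ *
      (1 / 2 * (e0 a ε η + d1 a ε η + b a ξ * bc a ε 0 ξ * (g0 a ε η + f1 a ε η))
        + 2 * (bc a ε 0 ξ * bc a ε 0 η * bc a ε 1 η
          + (l0 a ε η - bc a ε 0 ξ * κ0 a ε η))) *
      hfun 3 (2 / ε * s a ε η ξ)

/-! ### The schemes -/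

/-- The matrix with rows `(0, conj q)` and `(q, 0)`. -/
def offDiag (q : ℂ) : Matrix (Fin 2) (Fin 2) ℂ := !![0, starRingEnd ℂ q; q, 0]

/-- The matrix `diag(q, conj q)`. -/
def onDiag (q : ℂ) : Matrix (Fin 2) (Fin 2) ℂ := !![q, 0; 0, starRingEnd ℂ q]

/-- The matrix `I + A¹ + A²` of one step of WKB2 from `ξ` to `η`. -/
def step2 (a : ℝ → ℝ) (ε η ξ : ℝ) : Matrix (Fin 2) (Fin 2) ℂ :=
  1 + (ε : ℂ) • offDiag (Q1 a ε 2 η ξ) + (ε : ℂ) ^ 2 • onDiag (Q22 a ε η ξ)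

/-- The matrix `I + A¹ + A² + A³` of one step of WKB3 from `ξ` to `η`. -/
def step3 (a : ℝ → ℝ) (ε η ξ : ℝ) : Matrix (Fin 2) (Fin 2) ℂ :=
  1 + (ε : ℂ) • offDiag (Q1 a ε 3 η ξ) + (ε : ℂ) ^ 2 • onDiag (Q23 a ε η ξ)
    + (ε : ℂ) ^ 3 • offDiag (Q33 a ε η ξ)

/-- The grid point `x_n = n h` for the step size `h = 1 / N`. -/
def grid (N n : ℕ) : ℝ := n / N

/-- The sequence `Z_n` of a one-step scheme on the grid with step size `1 / N`, where
`step η ξ` is the matrix of the step from `ξ` to `η` and `ZI` is the initial vector. -/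
def iterZ (step : ℝ → ℝ → Matrix (Fin 2) (Fin 2) ℂ) (N : ℕ) (ZI : Fin 2 → ℂ) :
    ℕ → Fin 2 → ℂ
  | 0 => ZI
  | n + 1 => step (grid N (n + 1)) (grid N n) *ᵥ iterZ step N ZI n

/-- The approximations `Z_n` of WKB2, started with `Z_0 = P U(0)`. -/
def Z2 (a : ℝ → ℝ) (ε : ℝ) (φ : ℝ → ℂ) (N n : ℕ) : Fin 2 → ℂ :=
  iterZ (step2 a ε) N (P *ᵥ exactU a ε φ 0) n

/-- The approximations `Z_n` of WKB3, started with `Z_0 = P U(0)`. -/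
def Z3 (a : ℝ → ℝ) (ε : ℝ) (φ : ℝ → ℂ) (N n : ℕ) : Fin 2 → ℂ :=
  iterZ (step3 a ε) N (P *ᵥ exactU a ε φ 0) n

/-- The backward transformation `P⁻¹ exp((i/ε) diag(t, -t)) Z`, with an approximate phase `t`. -/
def backU (ε t : ℝ) (Z : Fin 2 → ℂ) : Fin 2 → ℂ :=
  Pinv *ᵥ (expPhase ε t *ᵥ Z)

/-- A numerical integration method: for each step size `1 / N` and each `n`, a linear rule
`f ↦ I N n f` that is meant to approximate `∫ f` from `0` to the grid point `n / N` (for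
instance a weighted sum of values of `f`). -/
abbrev IntegrationMethod : Type := ℕ → ℕ → ((ℝ → ℝ) →ₗ[ℝ] ℝ)

/-- The method has order `γ`: for every smooth integrand on `[0, 1]`, the error is `O(h ^ γ)`
with `h = 1 / N`, uniformly over the grid points. -/
def IntegrationMethod.HasOrder (I : IntegrationMethod) (γ : ℝ) : Prop :=
  ∀ f : ℝ → ℝ, ContDiffOn ℝ ∞ f (Set.Icc 0 1) →
    ∃ K : ℝ, ∀ N : ℕ, 1 ≤ N → ∀ n : ℕ, n ≤ N →
      |I N n f - ∫ τ in (0 : ℝ)..grid N n, f τ| ≤ K * (1 / (N : ℝ)) ^ γ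

/-- The approximation `φ_n` of the phase `φ(x_n)` computed by the integration method. -/
def phaseApprox (I : IntegrationMethod) (a : ℝ → ℝ) (ε : ℝ) (N n : ℕ) : ℝ :=
  I N n (phaseDeriv a ε)

end WKB

end

/-! The vector Z solves Z' = εNZ, where N is off-diagonal with entries b·conj(E) and bE, E =
e^{2iφ/ε}. Indeed P diagonalizes the leading part of the first-order system for U, and the
correction −ε²b in the phase removes what is left on the diagonal (`isPair_exactZ`). The entries of
εN have modulus ε|b|, so Z is bounded uniformly in ε (`exists_bound_exactZ`), and stopping the
Picard series based at ξ after P terms costs O((ε(x−ξ))^(P+1)) (`IsPair.taylor_two`,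
`IsPair.taylor_three`).

It remains to compare the iterated oscillatory integrals m₁, m₂, m₃ with the closed formulas Q. This
is integration by parts read backwards: differentiate m − q and use b = 2φ'b₀, b_p' = 2φ'b_{p+1} and
w_{p+1}' = 2iφ'w_p, where w_p = ε^p h_p(σ). Everything cancels except an explicit remainder. Since
w_p = O((x−ξ)^p) uniformly in ε (`OO_w`), that remainder is O(ε^j (x−ξ)^k) with known j and k, and
integration gains one more power of the step (`OO.integrate`). Where conjugate exponentials meet, a
non-oscillating integral appears and is left to the trapezoidal or Simpson rule. With the prefactors
ε, ε², ε³ the local errors are O(ε³h³) for WKB2 and O(ε⁴h⁴) for WKB3, except for the Simpson error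
of bb₀, which is O(ε³h⁵) and is the origin of max(ε, h).

One step is I + O(h), so the local errors accumulate with a bounded amplification factor and one
power of h is lost (`norm_iterZ_sub_le`). In the passage back to U the quadrature error of the phase
is divided by ε, which gives h^γ/ε. Constants are uniform in ε because φ' stays away from 0
uniformly (`Admissible.phaseDeriv_lower`). -/

noncomputable section

namespace WKB

section

/-! ### Families of functions with uniformly bounded derivatives -/

/-- The functions `F ε`, `0 < ε ≤ ε₀`, are `k` times differentiable on `[0, 1]` and their
derivatives up to the order `k` are bounded uniformly in `ε`. -/
def CkBounded (ε₀ : ℝ) : ℕ → (ℝ → ℝ → ℝ) → Prop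
  | 0, F => ∃ C : ℝ, ∀ ε, 0 < ε → ε ≤ ε₀ → ∀ x ∈ Set.Icc (0 : ℝ) 1, |F ε x| ≤ C
  | k + 1, F => (∃ C : ℝ, ∀ ε, 0 < ε → ε ≤ ε₀ → ∀ x ∈ Set.Icc (0 : ℝ) 1, |F ε x| ≤ C) ∧
      (∀ ε, 0 < ε → ε ≤ ε₀ → DifferentiableOn ℝ (F ε) (Set.Icc 0 1)) ∧
      CkBounded ε₀ k (fun ε => D (F ε))

/-- All derivatives of the functions `F ε`, `0 < ε ≤ ε₀`, are bounded uniformly in `ε`. -/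
def SmoothFamily (ε₀ : ℝ) (F : ℝ → ℝ → ℝ) : Prop := ∀ k, CkBounded ε₀ k F

variable {ε₀ : ℝ} {F G : ℝ → ℝ → ℝ} {k : ℕ}

theorem uniqueDiff {x : ℝ} (hx : x ∈ Set.Icc (0 : ℝ) 1) :
    UniqueDiffWithinAt ℝ (Set.Icc (0 : ℝ) 1) x :=
  uniqueDiffOn_Icc one_pos x hx

theorem D_eq {E : Type*} [NormedAddCommGroup E] [NormedSpace ℝ E] {f : ℝ → E} {f' : E} {x : ℝ}
    (hx : x ∈ Set.Icc (0 : ℝ) 1) (h : HasDerivWithinAt f f' (Set.Icc 0 1) x) : D f x = f' :=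
  h.derivWithin (uniqueDiff hx)

theorem CkBounded.bounded (h : CkBounded ε₀ k F) : CkBounded ε₀ 0 F := by
  cases k with
  | zero => exact h
  | succ k => exact h.1

theorem CkBounded.of_succ (h : CkBounded ε₀ (k + 1) F) : CkBounded ε₀ k F := by
  induction k generalizing F with
  | zero => exact h.bounded
  | succ k ih => exact ⟨h.1, h.2.1, ih h.2.2⟩

/-- `D` is taken within [0, 1], so agreement on that interval also transfers the derivatives. -/
theorem CkBounded.congr (h : CkBounded ε₀ k F)
    (hFG : ∀ ε, 0 < ε → ε ≤ ε₀ → ∀ x ∈ Set.Icc (0 : ℝ) 1, G ε x = F ε x) :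
    CkBounded ε₀ k G := by
  induction k generalizing F G with
  | zero =>
    obtain ⟨C, hC⟩ := h
    exact ⟨C, fun ε h0 h1 x hx => by rw [hFG ε h0 h1 x hx]; exact hC ε h0 h1 x hx⟩
  | succ k ih =>
    obtain ⟨⟨C, hC⟩, hd, hk⟩ := h
    refine ⟨⟨C, fun ε h0 h1 x hx => by rw [hFG ε h0 h1 x hx]; exact hC ε h0 h1 x hx⟩,
      fun ε h0 h1 => (hd ε h0 h1).congr (hFG ε h0 h1), ih hk fun ε h0 h1 x hx => ?_⟩
    exact derivWithin_congr (hFG ε h0 h1) (hFG ε h0 h1 x hx)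

theorem CkBounded.add (hF : CkBounded ε₀ k F) (hG : CkBounded ε₀ k G) :
    CkBounded ε₀ k (fun ε x => F ε x + G ε x) := by
  induction k generalizing F G with
  | zero =>
    obtain ⟨C, hC⟩ := hF
    obtain ⟨C', hC'⟩ := hG
    exact ⟨C + C', fun ε h0 h1 x hx =>
      (abs_add_le _ _).trans (add_le_add (hC ε h0 h1 x hx) (hC' ε h0 h1 x hx))⟩
  | succ k ih =>
    refine ⟨?_, fun ε h0 h1 => (hF.2.1 ε h0 h1).add (hG.2.1 ε h0 h1),
      (ih hF.2.2 hG.2.2).congr fun ε h0 h1 x hx => ?_⟩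
    · obtain ⟨C, hC⟩ := hF.1
      obtain ⟨C', hC'⟩ := hG.1
      exact ⟨C + C', fun ε h0 h1 x hx =>
        (abs_add_le _ _).trans (add_le_add (hC ε h0 h1 x hx) (hC' ε h0 h1 x hx))⟩
    · exact D_eq hx ((hF.2.1 ε h0 h1 x hx).hasDerivWithinAt.add
        (hG.2.1 ε h0 h1 x hx).hasDerivWithinAt)

theorem CkBounded.mul (hF : CkBounded ε₀ k F) (hG : CkBounded ε₀ k G) :
    CkBounded ε₀ k (fun ε x => F ε x * G ε x) := by
  have key : ∀ {F G : ℝ → ℝ → ℝ}, CkBounded ε₀ 0 F → CkBounded ε₀ 0 G →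
      CkBounded ε₀ 0 (fun ε x => F ε x * G ε x) := by
    rintro F G ⟨C, hC⟩ ⟨C', hC'⟩
    refine ⟨C * C', fun ε h0 h1 x hx => ?_⟩
    rw [abs_mul]
    exact mul_le_mul (hC ε h0 h1 x hx) (hC' ε h0 h1 x hx) (abs_nonneg _)
      ((abs_nonneg _).trans (hC ε h0 h1 x hx))
  induction k generalizing F G with
  | zero => exact key hF hG
  | succ k ih =>
    refine ⟨key hF.bounded hG.bounded, fun ε h0 h1 => (hF.2.1 ε h0 h1).mul (hG.2.1 ε h0 h1),
      ((ih hF.2.2 hG.of_succ).add (ih hF.of_succ hG.2.2)).congr fun ε h0 h1 x hx => ?_⟩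
    exact D_eq hx ((hF.2.1 ε h0 h1 x hx).hasDerivWithinAt.mul
      (hG.2.1 ε h0 h1 x hx).hasDerivWithinAt)

theorem SmoothFamily.add (hF : SmoothFamily ε₀ F) (hG : SmoothFamily ε₀ G) :
    SmoothFamily ε₀ (fun ε x => F ε x + G ε x) := fun k => (hF k).add (hG k)

theorem SmoothFamily.mul (hF : SmoothFamily ε₀ F) (hG : SmoothFamily ε₀ G) :
    SmoothFamily ε₀ (fun ε x => F ε x * G ε x) := fun k => (hF k).mul (hG k)

theorem SmoothFamily.derivD (hF : SmoothFamily ε₀ F) : SmoothFamily ε₀ (fun ε => D (F ε)) :=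
  fun k => (hF (k + 1)).2.2

theorem SmoothFamily.differentiableOn (hF : SmoothFamily ε₀ F) {ε : ℝ} (h0 : 0 < ε)
    (h1 : ε ≤ ε₀) : DifferentiableOn ℝ (F ε) (Set.Icc 0 1) := (hF 1).2.1 ε h0 h1

theorem SmoothFamily.of_const {c : ℝ → ℝ} {C : ℝ} (hc : ∀ ε, 0 < ε → ε ≤ ε₀ → |c ε| ≤ C) :
    SmoothFamily ε₀ (fun ε _ => c ε) := by
  intro k
  induction k generalizing c C with
  | zero => exact ⟨C, fun ε h0 h1 x _ => hc ε h0 h1⟩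
  | succ k ih =>
    refine ⟨⟨C, fun ε h0 h1 x _ => hc ε h0 h1⟩, fun ε h0 h1 => differentiableOn_const _,
      (ih (c := fun _ => 0) (C := 0) (by simp)).congr fun ε h0 h1 x hx => ?_⟩
    exact D_eq hx (hasDerivWithinAt_const _ _ _)

theorem contDiffOn_D {f : ℝ → ℝ} (hf : ContDiffOn ℝ ∞ f (Set.Icc 0 1)) :
    ContDiffOn ℝ ∞ (D f) (Set.Icc 0 1) :=
  hf.derivWithin (uniqueDiffOn_Icc one_pos) (by simp)

theorem SmoothFamily.of_contDiffOn {f : ℝ → ℝ} (hf : ContDiffOn ℝ ∞ f (Set.Icc 0 1)) :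
    SmoothFamily ε₀ (fun _ => f) := by
  intro k
  have key : ∀ {f : ℝ → ℝ}, ContDiffOn ℝ ∞ f (Set.Icc 0 1) → CkBounded ε₀ 0 (fun _ => f) := by
    intro f hf
    obtain ⟨C, hC⟩ := isCompact_Icc.exists_bound_of_continuousOn hf.continuousOn
    exact ⟨C, fun _ _ _ x hx => hC x hx⟩
  induction k generalizing f with
  | zero => exact key hf
  | succ k ih =>
    exact ⟨key hf, fun _ _ _ => hf.differentiableOn (by simp), ih (contDiffOn_D hf)⟩

/-- Since (1/F)' = −F'·(1/F)², a bound of order k + 1 on 1/F follows from bounds of order k on F'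
and on 1/F itself. -/
theorem SmoothFamily.inv (hF : SmoothFamily ε₀ F) {c : ℝ} (hc : 0 < c)
    (hFc : ∀ ε, 0 < ε → ε ≤ ε₀ → ∀ x ∈ Set.Icc (0 : ℝ) 1, c ≤ |F ε x|) :
    SmoothFamily ε₀ (fun ε x => (F ε x)⁻¹) := by
  have h0 : CkBounded ε₀ 0 (fun ε x => (F ε x)⁻¹) := by
    refine ⟨c⁻¹, fun ε h0 h1 x hx => ?_⟩
    rw [abs_inv]
    exact inv_anti₀ hc (hFc ε h0 h1 x hx)
  have hne : ∀ ε, 0 < ε → ε ≤ ε₀ → ∀ x ∈ Set.Icc (0 : ℝ) 1, F ε x ≠ 0 :=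
    fun ε h0 h1 x hx => abs_pos.1 (hc.trans_le (hFc ε h0 h1 x hx))
  intro k
  induction k with
  | zero => exact h0
  | succ k ih =>
    refine ⟨h0, fun ε h0 h1 => (hF.differentiableOn h0 h1).inv (hne ε h0 h1),
      ((((SmoothFamily.of_const (c := fun _ => -1) (C := 1) (by simp)) k).mul
        (hF.derivD k)).mul (ih.mul ih)).congr fun ε h0 h1 x hx => ?_⟩
    refine D_eq hx (((hF.differentiableOn h0 h1 x hx).hasDerivWithinAt.inv
      (hne ε h0 h1 x hx)).congr_deriv ?_)
    have := hne ε h0 h1 x hx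
    simp only [D]
    field_simp

/-! ### The coefficient functions -/

/-- The standing assumptions on the coefficient `a` and on the range of `ε`. -/
structure Admissible (a : ℝ → ℝ) (ε₀ : ℝ) : Prop where
  contDiffOn : ContDiffOn ℝ ∞ a (Set.Icc 0 1)
  pos : ∀ x ∈ Set.Icc (0 : ℝ) 1, 0 < a x
  le_one : ε₀ ≤ 1
  phaseDeriv_ne : ∀ ε : ℝ, 0 < ε → ε ≤ ε₀ → ∀ x ∈ Set.Icc (0 : ℝ) 1, phaseDeriv a ε x ≠ 0

namespace Admissible

variable {a : ℝ → ℝ} (H : Admissible a ε₀)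
include H

theorem contDiffOn_rpow (p : ℝ) : ContDiffOn ℝ ∞ (fun x => a x ^ p) (Set.Icc 0 1) :=
  H.contDiffOn.rpow_const_of_ne fun x hx => (H.pos x hx).ne'

theorem contDiffOn_sqrt : ContDiffOn ℝ ∞ (fun x => √(a x)) (Set.Icc 0 1) :=
  H.contDiffOn.sqrt fun x hx => (H.pos x hx).ne'

theorem contDiffOn_b : ContDiffOn ℝ ∞ (b a) (Set.Icc 0 1) := by
  unfold b
  refine ContDiffOn.mul (ContDiffOn.neg (contDiffOn_const.div
    (contDiffOn_const.mul (H.contDiffOn_rpow _)) fun x hx => ?_))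
    (contDiffOn_D (contDiffOn_D (H.contDiffOn_rpow _)))
  exact mul_ne_zero two_ne_zero (Real.rpow_pos_of_pos (H.pos x hx) _).ne'

/-- Pointwise non-vanishing becomes a uniform bound by compactness of [0, ε₀] × [0, 1]. The range of
ε has to be closed up at 0. -/
theorem phaseDeriv_lower : ∃ c : ℝ, 0 < c ∧
    ∀ ε, 0 < ε → ε ≤ ε₀ → ∀ x ∈ Set.Icc (0 : ℝ) 1, c ≤ |phaseDeriv a ε x| := by
  have hcont : ContinuousOn (fun p : ℝ × ℝ => |phaseDeriv a p.1 p.2|)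
      (Set.Icc 0 ε₀ ×ˢ Set.Icc 0 1) := by
    unfold phaseDeriv
    refine ContinuousOn.abs (ContinuousOn.sub ?_ (ContinuousOn.mul (by fun_prop) ?_))
    · exact H.contDiffOn_sqrt.continuousOn.comp continuousOn_snd fun p hp => hp.2
    · exact H.contDiffOn_b.continuousOn.comp continuousOn_snd fun p hp => hp.2
  rcases lt_or_ge 0 ε₀ with h | h
  · obtain ⟨p, hp, hmin⟩ := (isCompact_Icc.prod isCompact_Icc).exists_isMinOn
      ⟨(0, 0), ⟨le_rfl, h.le⟩, ⟨le_rfl, zero_le_one⟩⟩ hcont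
    refine ⟨_, ?_, fun ε h0 h1 x hx => hmin (a := (ε, x)) ⟨⟨h0.le, h1⟩, hx⟩⟩
    refine abs_pos.2 ?_
    -- The hypothesis says nothing about ε = 0, but there φ' = √a > 0.
    rcases hp.1.1.eq_or_lt with h0 | h0
    · simpa [phaseDeriv, ← h0] using (Real.sqrt_pos.2 (H.pos _ hp.2)).ne'
    · exact H.phaseDeriv_ne _ h0 hp.1.2 _ hp.2
  · exact ⟨1, one_pos, fun ε h0 h1 => absurd (h0.trans_le (h1.trans h)) (lt_irrefl _)⟩

theorem smooth_b : SmoothFamily ε₀ (fun _ => b a) := .of_contDiffOn H.contDiffOn_b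

theorem smooth_phaseDeriv : SmoothFamily ε₀ (phaseDeriv a) := by
  have h : SmoothFamily ε₀ (fun ε x => √(a x) + -ε ^ 2 * b a x) := by
    refine (SmoothFamily.of_contDiffOn H.contDiffOn_sqrt).add (SmoothFamily.mul
      (.of_const (c := fun ε => -ε ^ 2) (C := 1) fun ε h0 h1 => ?_) H.smooth_b)
    rw [abs_neg, abs_of_nonneg (by positivity)]
    exact pow_le_one₀ h0.le (h1.trans H.le_one)
  exact fun k => (h k).congr fun ε _ _ x _ => by simp only [phaseDeriv]; ring

/-- All coefficients of the schemes arise from b by products, differentiation and division by 2φ',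
so this closure property gives their uniform bounds. -/
theorem smooth_div (hF : SmoothFamily ε₀ F) :
    SmoothFamily ε₀ (fun ε x => F ε x / (2 * phaseDeriv a ε x)) := by
  obtain ⟨c, hc, hlow⟩ := H.phaseDeriv_lower
  have h : SmoothFamily ε₀ (fun ε x => 2 * phaseDeriv a ε x) :=
    (SmoothFamily.of_const (c := fun _ => 2) (C := 2) (by simp)).mul H.smooth_phaseDeriv
  refine hF.mul (h.inv hc fun ε h0 h1 x hx => ?_)
  rw [abs_mul, abs_two]
  linarith [hlow ε h0 h1 x hx, abs_nonneg (phaseDeriv a ε x)]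

theorem smooth_bc (p : ℕ) : SmoothFamily ε₀ (fun ε => bc a ε p) := by
  induction p with
  | zero => exact H.smooth_div H.smooth_b
  | succ p ih => exact H.smooth_div ih.derivD

theorem smooth_c0 : SmoothFamily ε₀ (c0 a) := by
  have h := H.smooth_div ((H.smooth_b.mul H.smooth_b).mul (H.smooth_bc 0))
  exact fun k => (h k).congr fun ε _ _ x _ => by simp only [c0]; ring

theorem smooth_c1 : SmoothFamily ε₀ (c1 a) := H.smooth_div H.smooth_c0.derivD

theorem smooth_d0 : SmoothFamily ε₀ (d0 a) := H.smooth_div H.smooth_c0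

theorem smooth_d1 : SmoothFamily ε₀ (d1 a) := H.smooth_div H.smooth_d0.derivD

theorem smooth_e0 : SmoothFamily ε₀ (e0 a) := H.smooth_div H.smooth_c1

theorem smooth_f0 : SmoothFamily ε₀ (f0 a) := H.smooth_div (H.smooth_bc 0)

theorem smooth_f1 : SmoothFamily ε₀ (f1 a) := H.smooth_div H.smooth_f0.derivD

theorem smooth_g0 : SmoothFamily ε₀ (g0 a) := H.smooth_div (H.smooth_bc 1)

theorem smooth_κ0 : SmoothFamily ε₀ (κ0 a) := H.smooth_div (H.smooth_b.mul (H.smooth_bc 1))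

end Admissible

end

section

/-! ### Uniform estimates in `ε` and in the step `[ξ, x]` -/

/-- The admissible parameters: `0 < ε ≤ ε₀`, `ε ≤ 1` and `0 ≤ ξ ≤ x ≤ 1`. -/
structure Dom (ε₀ ε ξ x : ℝ) : Prop where
  pos : 0 < ε
  le : ε ≤ ε₀
  le_one : ε ≤ 1
  nonneg : 0 ≤ ξ
  ordered : ξ ≤ x
  right : x ≤ 1

/-- `f ε ξ x = O(ε ^ j (x - ξ) ^ k)` uniformly on the admissible parameters. -/
def OO (ε₀ : ℝ) (j k : ℕ) (f : ℝ → ℝ → ℝ → ℂ) : Prop :=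
  ∃ C : ℝ, 0 ≤ C ∧ ∀ ε ξ x, Dom ε₀ ε ξ x → ‖f ε ξ x‖ ≤ C * (ε ^ j * (x - ξ) ^ k)

variable {ε₀ ε ξ x : ℝ} {f g f' : ℝ → ℝ → ℝ → ℂ} {j k j' k' : ℕ} {F : ℝ → ℝ → ℝ}

theorem Dom.mem (h : Dom ε₀ ε ξ x) : x ∈ Set.Icc (0 : ℝ) 1 := ⟨h.nonneg.trans h.ordered, h.right⟩

theorem Dom.mem_left (h : Dom ε₀ ε ξ x) : ξ ∈ Set.Icc (0 : ℝ) 1 :=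
  ⟨h.nonneg, h.ordered.trans h.right⟩

theorem Dom.left (h : Dom ε₀ ε ξ x) : Dom ε₀ ε ξ ξ :=
  ⟨h.pos, h.le, h.le_one, h.nonneg, le_rfl, h.ordered.trans h.right⟩

theorem Dom.ne (h : Dom ε₀ ε ξ x) : (ε : ℂ) ≠ 0 := by exact_mod_cast h.pos.ne'

theorem OO.congr (hf : OO ε₀ j k f) (h : ∀ ε ξ x, Dom ε₀ ε ξ x → g ε ξ x = f ε ξ x) :
    OO ε₀ j k g := by
  obtain ⟨C, hC, hb⟩ := hf
  exact ⟨C, hC, fun ε ξ x d => by rw [h ε ξ x d]; exact hb ε ξ x d⟩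

theorem OO.add (hf : OO ε₀ j k f) (hg : OO ε₀ j k g) :
    OO ε₀ j k (fun ε ξ x => f ε ξ x + g ε ξ x) := by
  obtain ⟨C, hC, hb⟩ := hf
  obtain ⟨C', hC', hb'⟩ := hg
  refine ⟨C + C', by positivity, fun ε ξ x d => (norm_add_le _ _).trans ?_⟩
  rw [add_mul]
  exact add_le_add (hb ε ξ x d) (hb' ε ξ x d)

theorem OO.mul (hf : OO ε₀ j k f) (hg : OO ε₀ j' k' g) :
    OO ε₀ (j + j') (k + k') (fun ε ξ x => f ε ξ x * g ε ξ x) := by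
  obtain ⟨C, hC, hb⟩ := hf
  obtain ⟨C', hC', hb'⟩ := hg
  refine ⟨C * C', by positivity, fun ε ξ x d => ?_⟩
  rw [norm_mul]
  refine (mul_le_mul (hb ε ξ x d) (hb' ε ξ x d) (norm_nonneg _)
    ((norm_nonneg _).trans (hb ε ξ x d))).trans (le_of_eq ?_)
  ring

/-- Both ε and x − ξ lie in [0, 1], so lowering an exponent only weakens the bound. -/
theorem OO.mono (hf : OO ε₀ j k f) (hj : j' ≤ j) (hk : k' ≤ k) : OO ε₀ j' k' f := by
  obtain ⟨C, hC, hb⟩ := hf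
  refine ⟨C, hC, fun ε ξ x d => (hb ε ξ x d).trans ?_⟩
  have := d.pos.le
  have h1 : 0 ≤ x - ξ := sub_nonneg.2 d.ordered
  have h2 : x - ξ ≤ 1 := by linarith [d.right, d.nonneg]
  exact mul_le_mul_of_nonneg_left (mul_le_mul (pow_le_pow_of_le_one d.pos.le d.le_one hj)
    (pow_le_pow_of_le_one h1 h2 hk) (by positivity) (by positivity)) hC

theorem OO.const (c : ℂ) : OO ε₀ 0 0 (fun _ _ _ => c) :=
  ⟨‖c‖, norm_nonneg _, fun _ _ _ _ => by simp⟩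

theorem OO.epsPow (j : ℕ) : OO ε₀ j 0 (fun ε _ _ => (ε : ℂ) ^ j) :=
  ⟨1, zero_le_one, fun ε _ _ d => by simp [abs_of_pos d.pos]⟩

theorem OO.step : OO ε₀ 0 1 (fun _ ξ x => ((x - ξ : ℝ) : ℂ)) :=
  ⟨1, zero_le_one, fun ε ξ x d => by
    rw [Complex.norm_real, Real.norm_of_nonneg (sub_nonneg.2 d.ordered)]; simp⟩

theorem OO.smul (c : ℂ) (hf : OO ε₀ j k f) : OO ε₀ j k (fun ε ξ x => c * f ε ξ x) := by
  simpa using (OO.const c).mul hf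

theorem OO.eps_mul (i : ℕ) (hf : OO ε₀ j k f) :
    OO ε₀ (i + j) k (fun ε ξ x => (ε : ℂ) ^ i * f ε ξ x) := by
  simpa using (OO.epsPow i).mul hf

theorem OO.bdd_mul (hg : OO ε₀ 0 0 g) (hf : OO ε₀ j k f) :
    OO ε₀ j k (fun ε ξ x => g ε ξ x * f ε ξ x) := by
  simpa using hg.mul hf

/-- A function that vanishes at `x = ξ` and whose derivative is `O(ε ^ j (x - ξ) ^ k)` is
`O(ε ^ j (x - ξ) ^ (k + 1))`. -/
theorem OO.integrate (hf' : OO ε₀ j k f') (h0 : ∀ ε ξ, Dom ε₀ ε ξ ξ → f ε ξ ξ = 0)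
    (hd : ∀ ε ξ x, Dom ε₀ ε ξ x → HasDerivWithinAt (f ε ξ) (f' ε ξ x) (Set.Icc 0 1) x) :
    OO ε₀ j (k + 1) f := by
  obtain ⟨C, hC, hb⟩ := hf'
  refine ⟨C, hC, fun ε ξ x d => ?_⟩
  have hdom : ∀ y ∈ Set.Icc ξ x, Dom ε₀ ε ξ y := fun y hy =>
    ⟨d.pos, d.le, d.le_one, d.nonneg, hy.1, hy.2.trans d.right⟩
  have h := (convex_Icc ξ x).norm_image_sub_le_of_norm_hasDerivWithin_le
    (f := f ε ξ) (f' := f' ε ξ) (C := C * (ε ^ j * (x - ξ) ^ k)) (x := ξ) (y := x)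
    (fun y hy => (hd ε ξ y (hdom y hy)).mono (Set.Icc_subset_Icc d.nonneg d.right))
    (fun y hy => (hb ε ξ y (hdom y hy)).trans (by
      have := d.pos.le
      have h1 : 0 ≤ y - ξ := sub_nonneg.2 hy.1
      have h2 : y - ξ ≤ x - ξ := by linarith [hy.2]
      gcongr)) ⟨le_rfl, d.ordered⟩ ⟨d.ordered, le_rfl⟩
  rw [h0 ε ξ d.left, sub_zero, Real.norm_of_nonneg (sub_nonneg.2 d.ordered)] at h
  refine h.trans (le_of_eq ?_)
  ring

theorem SmoothFamily.OO_right (hF : SmoothFamily ε₀ F) :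
    OO ε₀ 0 0 (fun ε _ x => (F ε x : ℂ)) := by
  obtain ⟨C, hC⟩ := hF 0
  refine ⟨|C|, abs_nonneg _, fun ε ξ x d => ?_⟩
  simpa using (hC ε d.pos d.le x d.mem).trans (le_abs_self C)

theorem SmoothFamily.OO_left (hF : SmoothFamily ε₀ F) :
    OO ε₀ 0 0 (fun ε ξ _ => (F ε ξ : ℂ)) := by
  obtain ⟨C, hC⟩ := hF 0
  refine ⟨|C|, abs_nonneg _, fun ε ξ x d => ?_⟩
  simpa using (hC ε d.pos d.le ξ d.mem_left).trans (le_abs_self C)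

theorem SmoothFamily.hasDeriv (hF : SmoothFamily ε₀ F) (d : Dom ε₀ ε ξ x) :
    HasDerivWithinAt (fun y => (F ε y : ℂ)) ((D (F ε) x : ℝ) : ℂ) (Set.Icc 0 1) x :=
  (hF.differentiableOn d.pos d.le x d.mem).hasDerivWithinAt.ofReal_comp

theorem SmoothFamily.OO_sub (hF : SmoothFamily ε₀ F) :
    OO ε₀ 0 1 (fun ε ξ x => (F ε x : ℂ) - F ε ξ) :=
  hF.derivD.OO_right.integrate (by simp) fun _ _ _ d => (hF.hasDeriv d).sub_const _

/-! ### Quadrature errors -/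

/-- The expression is twice the x-derivative of the trapezoidal error on [ξ, x]. It vanishes at x =
ξ and its own derivative is (x − ξ)F''. -/
theorem OO_trapezoid_deriv (hF : SmoothFamily ε₀ F) :
    OO ε₀ 0 2 (fun ε ξ x => (F ε ξ : ℂ) - F ε x + (x - ξ : ℝ) * D (F ε) x) := by
  have h : OO ε₀ 0 1 (fun ε ξ x => ((x - ξ : ℝ) : ℂ) * D (D (F ε)) x) := by
    simpa using OO.step.mul hF.derivD.derivD.OO_right
  refine h.integrate (by simp) fun ε ξ x d => ?_
  refine (((hF.hasDeriv d).const_sub _).add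
    (((hasDerivWithinAt_id x _).sub_const ξ).ofReal_comp.mul (hF.derivD.hasDeriv d))).congr_deriv ?_
  simp

theorem SmoothFamily.hasDeriv_mid (hF : SmoothFamily ε₀ F) (d : Dom ε₀ ε ξ x) :
    HasDerivWithinAt (fun y => (F ε ((ξ + y) / 2) : ℂ)) (((D (F ε) ((ξ + x) / 2) : ℝ) : ℂ) / 2)
      (Set.Icc 0 1) x := by
  have hmaps : Set.MapsTo (fun y : ℝ => (ξ + y) / 2) (Set.Icc 0 1) (Set.Icc 0 1) := by
    intro y hy
    constructor <;> linarith [hy.1, hy.2, d.mem_left.1, d.mem_left.2]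
  have h1 : HasDerivWithinAt (fun y : ℝ => (ξ + y) / 2) (1 / 2) (Set.Icc 0 1) x :=
    ((hasDerivWithinAt_id x _).const_add ξ).div_const 2
  have h2 := (hF.differentiableOn d.pos d.le _ (hmaps d.mem)).hasDerivWithinAt.scomp x h1 hmaps
  refine h2.ofReal_comp.congr_deriv ?_
  simp [D]
  ring

theorem Dom.mid (d : Dom ε₀ ε ξ x) : Dom ε₀ ε ξ ((ξ + x) / 2) :=
  ⟨d.pos, d.le, d.le_one, d.nonneg, by linarith [d.ordered], by linarith [d.ordered, d.right]⟩

theorem SmoothFamily.OO_mid (hF : SmoothFamily ε₀ F) :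
    OO ε₀ 0 0 (fun ε ξ x => (F ε ((ξ + x) / 2) : ℂ)) := by
  obtain ⟨C, hC⟩ := hF 0
  refine ⟨|C|, abs_nonneg _, fun ε ξ x d => ?_⟩
  simpa using (hC ε d.pos d.le _ d.mid.mem).trans (le_abs_self C)

theorem SmoothFamily.OO_mid_sub (hF : SmoothFamily ε₀ F) :
    OO ε₀ 0 1 (fun ε ξ x => (F ε ((ξ + x) / 2) : ℂ) - F ε x) := by
  have h := (hF.derivD.OO_mid.smul (1 / 2)).add (hF.derivD.OO_right.smul (-1))
  refine h.integrate (fun ε ξ d => by simp) fun ε ξ x d => ?_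
  exact ((hF.hasDeriv_mid d).sub (hF.hasDeriv d)).congr_deriv (by ring)

/-- The expression is the x-derivative of the Simpson error on [ξ, x]. Its x-derivatives up to order
three vanish at x = ξ, so four integrations of bounded quantities give the fourth power. -/
theorem OO_simpson_deriv (hF : SmoothFamily ε₀ F) :
    OO ε₀ 0 4 (fun ε ξ x => ((F ε ξ : ℂ) + 4 * F ε ((ξ + x) / 2) + F ε x) / 6
      + (x - ξ : ℝ) * (2 * D (F ε) ((ξ + x) / 2) + D (F ε) x) / 6 - F ε x) := by
  have hlin : ∀ ξ x : ℝ, HasDerivWithinAt (fun y : ℝ => ((y - ξ : ℝ) : ℂ)) 1 (Set.Icc 0 1) x :=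
    fun ξ x => ((hasDerivWithinAt_id x _).sub_const ξ).ofReal_comp.congr_deriv (by simp)
  have F2 := hF.derivD.derivD
  have F3 := F2.derivD
  have F4 := F3.derivD
  -- `h1`, `h2`, `h3` bound the third, second and first x-derivatives of the expression; each is
  -- integrated to obtain the next.
  have h1 := (F3.OO_mid_sub.smul (1 / 3)).add ((OO.step.mul
    ((F4.OO_mid.smul (1 / 24)).add (F4.OO_right.smul (1 / 6)))))
  have h2 : OO ε₀ 0 2 (fun ε ξ x => (((D (D (F ε)) ((ξ + x) / 2) : ℝ) : ℂ) - D (D (F ε)) x) / 2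
      + (x - ξ : ℝ) * (D (D (D (F ε))) ((ξ + x) / 2) / 12 + D (D (D (F ε))) x / 6)) := by
    refine h1.integrate (by simp) fun ε ξ x d => ?_
    refine ((((F2.hasDeriv_mid d).sub (F2.hasDeriv d)).div_const 2).add ((hlin ξ x).mul
      (((F3.hasDeriv_mid d).div_const 12).add ((F3.hasDeriv d).div_const 6)))).congr_deriv ?_
    simp only [Pi.add_apply]
    ring
  have h3 : OO ε₀ 0 3 (fun ε ξ x => (((D (F ε) ((ξ + x) / 2) : ℝ) : ℂ) - D (F ε) x) * (2 / 3)
      + (x - ξ : ℝ) * (D (D (F ε)) ((ξ + x) / 2) + D (D (F ε)) x) / 6) := by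
    refine h2.integrate (by simp) fun ε ξ x d => ?_
    refine ((((hF.derivD.hasDeriv_mid d).sub (hF.derivD.hasDeriv d)).mul_const (2 / 3)).add
      (((hlin ξ x).mul ((F2.hasDeriv_mid d).add (F2.hasDeriv d))).div_const 6)).congr_deriv ?_
    simp only [Pi.add_apply]
    ring
  refine h3.integrate (fun ε ξ d => by simp; ring) fun ε ξ x d => ?_
  refine ((((((hF.hasDeriv_mid d).const_mul 4).const_add _).add (hF.hasDeriv d)).div_const 6).add
    (((hlin ξ x).mul (((hF.derivD.hasDeriv_mid d).const_mul 2).add (hF.derivD.hasDeriv d))).div_const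
      6)|>.sub (hF.hasDeriv d)).congr_deriv ?_
  simp only [Pi.add_apply]
  ring

/-! ### The phase and the functions `h_p` -/

/-- The integrand is controlled on [0, 1] only. Extending it by its end values makes it continuous
on the whole line, where the fundamental theorem of calculus applies, and the derivative is then
restricted to [0, 1]. -/
theorem exists_antideriv {E : Type*} [NormedAddCommGroup E] [NormedSpace ℝ E] [CompleteSpace E]
    {f : ℝ → E} (hf : ContinuousOn f (Set.Icc 0 1)) (ξ : ℝ) :
    ∃ F : ℝ → E, F ξ = 0 ∧ ∀ x ∈ Set.Icc (0 : ℝ) 1, HasDerivWithinAt F (f x) (Set.Icc 0 1) x := by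
  have hc : Continuous (Set.IccExtend (zero_le_one' ℝ) ((Set.Icc (0 : ℝ) 1).domRestrict f)) :=
    hf.domRestrict.Icc_extend'
  refine ⟨fun x => ∫ τ in ξ..x, Set.IccExtend (zero_le_one' ℝ) ((Set.Icc (0 : ℝ) 1).domRestrict f) τ,
    by simp, fun x hx => ?_⟩
  have h := (hc.integral_hasStrictDerivAt ξ x).hasDerivAt.hasDerivWithinAt (s := Set.Icc 0 1)
  rwa [Set.IccExtend_of_mem _ _ hx] at h

theorem hasDerivWithinAt_integral {f : ℝ → ℝ} (hf : ContinuousOn f (Set.Icc 0 1)) {x : ℝ}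
    (hx : x ∈ Set.Icc (0 : ℝ) 1) :
    HasDerivWithinAt (fun y => ∫ τ in (0 : ℝ)..y, f τ) (f x) (Set.Icc 0 1) x := by
  have hc : Continuous (Set.IccExtend (zero_le_one' ℝ) ((Set.Icc (0 : ℝ) 1).domRestrict f)) :=
    hf.domRestrict.Icc_extend'
  have h := (hc.integral_hasStrictDerivAt 0 x).hasDerivAt.hasDerivWithinAt (s := Set.Icc 0 1)
  rw [Set.IccExtend_of_mem _ _ hx] at h
  have heq : ∀ y ∈ Set.Icc (0 : ℝ) 1, ∫ τ in (0 : ℝ)..y, f τ =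
      ∫ τ in (0 : ℝ)..y, Set.IccExtend (zero_le_one' ℝ) ((Set.Icc (0 : ℝ) 1).domRestrict f) τ := by
    intro y hy
    refine intervalIntegral.integral_congr fun τ hτ => ?_
    rw [Set.uIcc_of_le hy.1] at hτ
    exact (Set.IccExtend_of_mem (zero_le_one' ℝ) ((Set.Icc (0 : ℝ) 1).domRestrict f)
      ⟨hτ.1, hτ.2.trans hy.2⟩).symm
  exact h.congr heq (heq x hx)

theorem hfun_succ_zero (p : ℕ) : hfun (p + 1) 0 = 0 := by
  simp [hfun, Finset.sum_range_succ']

theorem hasDerivAt_hfun (p : ℕ) (x : ℝ) :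
    HasDerivAt (hfun (p + 1)) (Complex.I * hfun p x) x := by
  have hlin : HasDerivAt (fun y : ℝ => Complex.I * (y : ℂ)) Complex.I x := by
    simpa using (hasDerivAt_id x).ofReal_comp.const_mul Complex.I
  have hsum : HasDerivAt (fun y : ℝ => ∑ k ∈ Finset.range p,
      (Complex.I * (y : ℂ)) ^ (k + 1) / ((k + 1).factorial : ℂ))
      (∑ k ∈ Finset.range p, Complex.I * ((Complex.I * (x : ℂ)) ^ k / (k.factorial : ℂ))) x := by
    refine HasDerivAt.fun_sum fun k _ => ((hlin.pow (k + 1)).div_const _).congr_deriv ?_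
    have h1 : ((k.factorial : ℕ) : ℂ) ≠ 0 := by exact_mod_cast k.factorial_ne_zero
    have h2 : ((k : ℂ) + 1) ≠ 0 := by exact_mod_cast k.succ_ne_zero
    rw [Nat.factorial_succ, Nat.add_sub_cancel]
    push_cast
    field_simp
  have h := (hlin.cexp.sub_const 1).sub hsum
  have heq : hfun (p + 1) = fun y : ℝ => Complex.exp (Complex.I * y) - 1 -
      ∑ k ∈ Finset.range p, (Complex.I * (y : ℂ)) ^ (k + 1) / ((k + 1).factorial : ℂ) := by
    funext y
    simp only [hfun, Finset.sum_range_succ']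
    simp
    ring
  rw [heq]
  refine h.congr_deriv ?_
  rw [← Finset.mul_sum, hfun]
  ring

variable {a : ℝ → ℝ} (H : Admissible a ε₀)

/-- The function `ε ^ p h_p(σ)`, where `σ = 2 s / ε`. -/
def w (a : ℝ → ℝ) (p : ℕ) (ε ξ x : ℝ) : ℂ := (ε : ℂ) ^ p * hfun p (2 / ε * s a ε x ξ)

/-- The function `ε ^ p h_p(-σ)`, where `σ = 2 s / ε`. -/
def v (a : ℝ → ℝ) (p : ℕ) (ε ξ x : ℝ) : ℂ := (ε : ℂ) ^ p * hfun p (-(2 / ε) * s a ε x ξ)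

theorem s_self (a : ℝ → ℝ) (ε ξ : ℝ) : s a ε ξ ξ = 0 := by simp [s]

theorem w_self (p : ℕ) : w a (p + 1) ε ξ ξ = 0 := by simp [w, s_self, hfun_succ_zero]

theorem v_self (p : ℕ) : v a (p + 1) ε ξ ξ = 0 := by simp [v, s_self, hfun_succ_zero]

theorem w_zero_self : w a 0 ε ξ ξ = 1 := by simp [w, s_self, hfun]

theorem v_zero_self : v a 0 ε ξ ξ = 1 := by simp [v, s_self, hfun]

include H in
theorem hasDeriv_phase (d : Dom ε₀ ε ξ x) :
    HasDerivWithinAt (phase a ε) (phaseDeriv a ε x) (Set.Icc 0 1) x :=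
  hasDerivWithinAt_integral (H.smooth_phaseDeriv.differentiableOn d.pos d.le).continuousOn d.mem

include H in
theorem hasDeriv_s_real (d : Dom ε₀ ε ξ x) :
    HasDerivWithinAt (fun y => s a ε y ξ) (phaseDeriv a ε x) (Set.Icc 0 1) x :=
  (hasDeriv_phase H d).sub_const _

include H in
theorem hasDeriv_s (d : Dom ε₀ ε ξ x) :
    HasDerivWithinAt (fun y => (s a ε y ξ : ℂ)) (phaseDeriv a ε x : ℂ) (Set.Icc 0 1) x :=
  (hasDeriv_s_real H d).ofReal_comp

include H in
-- As h_{p+1}' = i h_p, the chain rule produces 2iφ'/ε, and one of the factors ε in ε^(p+1) absorbs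
-- the 1/ε. No negative power of ε survives.
theorem hasDeriv_w (p : ℕ) (d : Dom ε₀ ε ξ x) :
    HasDerivWithinAt (w a (p + 1) ε ξ) (2 * Complex.I * phaseDeriv a ε x * w a p ε ξ x)
      (Set.Icc 0 1) x := by
  have h := ((hasDerivAt_hfun p (2 / ε * s a ε x ξ)).scomp_hasDerivWithinAt x
    ((hasDeriv_s_real H d).const_mul (2 / ε))).const_mul ((ε : ℂ) ^ (p + 1))
  refine h.congr_deriv ?_
  have := d.ne
  simp only [w, Complex.real_smul, pow_succ]
  push_cast
  field_simp

include H in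
theorem hasDeriv_v (p : ℕ) (d : Dom ε₀ ε ξ x) :
    HasDerivWithinAt (v a (p + 1) ε ξ) (-2 * Complex.I * phaseDeriv a ε x * v a p ε ξ x)
      (Set.Icc 0 1) x := by
  have h := ((hasDerivAt_hfun p (-(2 / ε) * s a ε x ξ)).scomp_hasDerivWithinAt x
    ((hasDeriv_s_real H d).const_mul (-(2 / ε)))).const_mul ((ε : ℂ) ^ (p + 1))
  refine h.congr_deriv ?_
  have := d.ne
  simp only [v, Complex.real_smul, pow_succ]
  push_cast
  field_simp

theorem w_zero (a : ℝ → ℝ) (ε ξ x : ℝ) :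
    w a 0 ε ξ x = Complex.exp (((2 / ε * s a ε x ξ : ℝ) : ℂ) * Complex.I) := by
  simp only [w, hfun, Finset.range_zero, Finset.sum_empty, pow_zero, one_mul, sub_zero]
  rw [mul_comm]

theorem v_zero (a : ℝ → ℝ) (ε ξ x : ℝ) :
    v a 0 ε ξ x = Complex.exp (((-(2 / ε) * s a ε x ξ : ℝ) : ℂ) * Complex.I) := by
  simp only [v, hfun, Finset.range_zero, Finset.sum_empty, pow_zero, one_mul, sub_zero]
  rw [mul_comm]

theorem v_mul_w (a : ℝ → ℝ) (ε ξ x : ℝ) : v a 0 ε ξ x * w a 0 ε ξ x = 1 := by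
  rw [w_zero, v_zero, ← Complex.exp_add]
  simp

theorem norm_w_zero (a : ℝ → ℝ) (ε ξ x : ℝ) : ‖w a 0 ε ξ x‖ = 1 := by
  rw [w_zero, Complex.norm_exp_ofReal_mul_I]

theorem norm_v_zero (a : ℝ → ℝ) (ε ξ x : ℝ) : ‖v a 0 ε ξ x‖ = 1 := by
  rw [v_zero, Complex.norm_exp_ofReal_mul_I]

theorem w_one (a : ℝ → ℝ) (ε ξ x : ℝ) : w a 1 ε ξ x = ε * (w a 0 ε ξ x - 1) := by
  simp [w, hfun]

theorem v_one (a : ℝ → ℝ) (ε ξ x : ℝ) : v a 1 ε ξ x = ε * (v a 0 ε ξ x - 1) := by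
  simp [v, hfun]

theorem w_two (d : Dom ε₀ ε ξ x) :
    w a 2 ε ξ x = ε * w a 1 ε ξ x - 2 * Complex.I * ε * s a ε x ξ := by
  have := d.ne
  simp [w, hfun, Finset.sum_range_succ]
  field_simp
  ring

theorem v_two (d : Dom ε₀ ε ξ x) :
    v a 2 ε ξ x = ε * v a 1 ε ξ x + 2 * Complex.I * ε * s a ε x ξ := by
  have := d.ne
  simp [v, hfun, Finset.sum_range_succ]
  field_simp
  ring

include H in
-- For the pure exponential the factor 1/ε does appear. It is what lets εb₀w₀ reproduce the leading
-- term b w₀ when differentiated.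
theorem hasDeriv_w_zero (d : Dom ε₀ ε ξ x) :
    HasDerivWithinAt (w a 0 ε ξ) (2 * Complex.I * phaseDeriv a ε x / ε * w a 0 ε ξ x)
      (Set.Icc 0 1) x := by
  have hne := d.ne
  have heq : w a 0 ε ξ = fun y => w a 1 ε ξ y / ε + 1 := by
    funext y
    rw [w_one]
    field_simp
    ring
  nth_rewrite 1 [heq]
  refine (((hasDeriv_w H 0 d).div_const _).add_const _).congr_deriv ?_
  ring

include H in
theorem hasDeriv_v_zero (d : Dom ε₀ ε ξ x) :
    HasDerivWithinAt (v a 0 ε ξ) (-2 * Complex.I * phaseDeriv a ε x / ε * v a 0 ε ξ x)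
      (Set.Icc 0 1) x := by
  have hne := d.ne
  have heq : v a 0 ε ξ = fun y => v a 1 ε ξ y / ε + 1 := by
    funext y
    rw [v_one]
    field_simp
    ring
  nth_rewrite 1 [heq]
  refine (((hasDeriv_v H 0 d).div_const _).add_const _).congr_deriv ?_
  ring

include H in
-- The base case is |w₀| = 1; each further index is one integration of 2iφ'w_p from ξ.
theorem OO_w (p : ℕ) : OO ε₀ 0 p (w a p) := by
  induction p with
  | zero => exact ⟨1, zero_le_one, fun ε ξ x _ => by simp [norm_w_zero]⟩
  | succ p ih =>
    exact ((H.smooth_phaseDeriv.OO_right.smul (2 * Complex.I)).bdd_mul ih).integrate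
      (fun _ _ _ => w_self p) fun ε ξ x d => hasDeriv_w H p d

include H in
theorem OO_v (p : ℕ) : OO ε₀ 0 p (v a p) := by
  induction p with
  | zero => exact ⟨1, zero_le_one, fun ε ξ x _ => by simp [norm_v_zero]⟩
  | succ p ih =>
    exact ((H.smooth_phaseDeriv.OO_right.smul (-2 * Complex.I)).bdd_mul ih).integrate
      (fun _ _ _ => v_self p) fun ε ξ x d => hasDeriv_v H p d

include H in
theorem OO_s : OO ε₀ 0 1 (fun ε ξ x => (s a ε x ξ : ℂ)) :=
  H.smooth_phaseDeriv.OO_right.integrate (by simp [s_self]) fun ε ξ x d => hasDeriv_s H d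

end

section

/-! ### Approximation of the Picard iterates -/

variable {a : ℝ → ℝ} {ε₀ ε ξ x : ℝ}

section coefficients

variable (H : Admissible a ε₀)
include H

theorem phaseDeriv_ne (d : Dom ε₀ ε ξ x) : (phaseDeriv a ε x : ℂ) ≠ 0 := by
  exact_mod_cast H.phaseDeriv_ne ε d.pos d.le x d.mem

/-- Used to clear the denominators 2φ' from the coefficient definitions, so that the cancellations
below become polynomial identities. -/
theorem eq_of_div (d : Dom ε₀ ε ξ x) {y z : ℝ} (h : y = z / (2 * phaseDeriv a ε x)) :
    (z : ℂ) = 2 * phaseDeriv a ε x * y := by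
  have := phaseDeriv_ne H d
  rw [h]
  push_cast
  field_simp

theorem b_eq (d : Dom ε₀ ε ξ x) : (b a x : ℂ) = 2 * phaseDeriv a ε x * bc a ε 0 x :=
  eq_of_div H d rfl

theorem hasDeriv_bc (p : ℕ) (d : Dom ε₀ ε ξ x) :
    HasDerivWithinAt (fun y => (bc a ε p y : ℂ)) (2 * phaseDeriv a ε x * bc a ε (p + 1) x)
      (Set.Icc 0 1) x :=
  ((H.smooth_bc p).hasDeriv d).congr_deriv (eq_of_div H d rfl)

theorem hasDeriv_bc_sq (d : Dom ε₀ ε ξ x) :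
    HasDerivWithinAt (fun y => (bc a ε 0 y : ℂ) ^ 2)
      (4 * phaseDeriv a ε x * bc a ε 0 x * bc a ε 1 x) (Set.Icc 0 1) x :=
  ((hasDeriv_bc H 0 d).pow 2).congr_deriv (by simp; ring)

end coefficients

theorem hasDeriv_step (ξ x : ℝ) :
    HasDerivWithinAt (fun y : ℝ => ((y - ξ : ℝ) : ℂ)) 1 (Set.Icc 0 1) x :=
  ((hasDerivWithinAt_id x _).sub_const ξ).ofReal_comp.congr_deriv (by simp)

/-- The functions `mᵢ` are the first three Picard iterates, up to factors of modulus one. -/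
structure Picard (a : ℝ → ℝ) (ε₀ : ℝ) (m₁ m₂ m₃ : ℝ → ℝ → ℝ → ℂ) : Prop where
  zero₁ : ∀ ε ξ, Dom ε₀ ε ξ ξ → m₁ ε ξ ξ = 0
  zero₂ : ∀ ε ξ, Dom ε₀ ε ξ ξ → m₂ ε ξ ξ = 0
  zero₃ : ∀ ε ξ, Dom ε₀ ε ξ ξ → m₃ ε ξ ξ = 0
  deriv₁ : ∀ ε ξ x, Dom ε₀ ε ξ x →
    HasDerivWithinAt (m₁ ε ξ) (b a x * w a 0 ε ξ x) (Set.Icc 0 1) x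
  deriv₂ : ∀ ε ξ x, Dom ε₀ ε ξ x →
    HasDerivWithinAt (m₂ ε ξ) (b a x * v a 0 ε ξ x * m₁ ε ξ x) (Set.Icc 0 1) x
  deriv₃ : ∀ ε ξ x, Dom ε₀ ε ξ x →
    HasDerivWithinAt (m₃ ε ξ) (b a x * w a 0 ε ξ x * m₂ ε ξ x) (Set.Icc 0 1) x

theorem continuousOn_phase (H : Admissible a ε₀) (h0 : 0 < ε) (h1 : ε ≤ ε₀) :
    ContinuousOn (phase a ε) (Set.Icc 0 1) := fun x hx =>
  (hasDeriv_phase (x := x) H ⟨h0, h1, h1.trans H.le_one, hx.1, le_rfl, hx.2⟩).continuousWithinAt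

theorem exists_picard (H : Admissible a ε₀) :
    ∃ m₁ m₂ m₃ : ℝ → ℝ → ℝ → ℂ, Picard a ε₀ m₁ m₂ m₃ := by
  have key : ∀ ε ξ : ℝ, ∃ m₁ m₂ m₃ : ℝ → ℂ, Dom ε₀ ε ξ ξ →
      m₁ ξ = 0 ∧ m₂ ξ = 0 ∧ m₃ ξ = 0 ∧ ∀ x ∈ Set.Icc (0 : ℝ) 1,
        HasDerivWithinAt m₁ (b a x * w a 0 ε ξ x) (Set.Icc 0 1) x ∧
        HasDerivWithinAt m₂ (b a x * v a 0 ε ξ x * m₁ x) (Set.Icc 0 1) x ∧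
        HasDerivWithinAt m₃ (b a x * w a 0 ε ξ x * m₂ x) (Set.Icc 0 1) x := by
    intro ε ξ
    by_cases d : Dom ε₀ ε ξ ξ
    · have hb : ContinuousOn (fun x => (b a x : ℂ)) (Set.Icc 0 1) :=
        Complex.continuous_ofReal.comp_continuousOn H.contDiffOn_b.continuousOn
      have hp := continuousOn_phase H d.pos d.le
      have hw : ContinuousOn (w a 0 ε ξ) (Set.Icc 0 1) := by
        refine ContinuousOn.congr (f := fun x => Complex.exp
          (((2 / ε * (phase a ε x - phase a ε ξ) : ℝ) : ℂ) * Complex.I)) ?_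
          fun x _ => w_zero a ε ξ x
        exact Complex.continuous_exp.comp_continuousOn ((Complex.continuous_ofReal.comp_continuousOn
          (continuousOn_const.mul (hp.sub continuousOn_const))).mul continuousOn_const)
      have hv : ContinuousOn (v a 0 ε ξ) (Set.Icc 0 1) := by
        refine ContinuousOn.congr (f := fun x => Complex.exp
          (((-(2 / ε) * (phase a ε x - phase a ε ξ) : ℝ) : ℂ) * Complex.I)) ?_
          fun x _ => v_zero a ε ξ x
        exact Complex.continuous_exp.comp_continuousOn ((Complex.continuous_ofReal.comp_continuousOn
          (continuousOn_const.mul (hp.sub continuousOn_const))).mul continuousOn_const)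
      obtain ⟨m₁, h1, hd1⟩ := exists_antideriv (hb.mul hw) ξ
      have c1 : ContinuousOn m₁ (Set.Icc 0 1) := fun x hx => (hd1 x hx).continuousWithinAt
      obtain ⟨m₂, h2, hd2⟩ := exists_antideriv ((hb.mul hv).mul c1) ξ
      have c2 : ContinuousOn m₂ (Set.Icc 0 1) := fun x hx => (hd2 x hx).continuousWithinAt
      obtain ⟨m₃, h3, hd3⟩ := exists_antideriv ((hb.mul hw).mul c2) ξ
      exact ⟨m₁, m₂, m₃, fun _ => ⟨h1, h2, h3, fun x hx => ⟨hd1 x hx, hd2 x hx, hd3 x hx⟩⟩⟩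
    -- Outside the admissible parameters nothing is required, so any functions serve.
    · exact ⟨0, 0, 0, fun h => absurd h d⟩
  choose m₁ m₂ m₃ h using key
  exact ⟨m₁, m₂, m₃, fun ε ξ d => (h ε ξ d).1, fun ε ξ d => (h ε ξ d).2.1,
    fun ε ξ d => (h ε ξ d).2.2.1, fun ε ξ x d => ((h ε ξ d.left).2.2.2 x d.mem).1,
    fun ε ξ x d => ((h ε ξ d.left).2.2.2 x d.mem).2.1,
    fun ε ξ x d => ((h ε ξ d.left).2.2.2 x d.mem).2.2⟩

open Complex (I)

/-- The leading part of `Q₁ / E(ξ)`. -/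
def q11 (a : ℝ → ℝ) (ε ξ x : ℝ) : ℂ :=
  -(I * ε) * (bc a ε 0 x * w a 0 ε ξ x - bc a ε 0 ξ) + ε * (bc a ε 1 x * w a 1 ε ξ x)

/-- The quantity `Q₁² / E(ξ)`. -/
def q12 (a : ℝ → ℝ) (ε ξ x : ℝ) : ℂ :=
  -(I * ε) * (bc a ε 0 x * w a 0 ε ξ x - bc a ε 0 ξ)
  + ε ^ 2 * (bc a ε 1 x * w a 0 ε ξ x - bc a ε 1 ξ)
  + I * ε ^ 2 * (bc a ε 2 x * w a 1 ε ξ x) - ε ^ 2 * (bc a ε 3 x * w a 2 ε ξ x)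

/-- The quantity `Q₁³ / E(ξ)`. -/
def q13 (a : ℝ → ℝ) (ε ξ x : ℝ) : ℂ :=
  -(I * ε) * (bc a ε 0 x * w a 0 ε ξ x - bc a ε 0 ξ)
  + ε ^ 2 * (bc a ε 1 x * w a 0 ε ξ x - bc a ε 1 ξ)
  + I * ε ^ 3 * (bc a ε 2 x * w a 0 ε ξ x - bc a ε 2 ξ)
  - ε ^ 3 * (bc a ε 3 x * w a 1 ε ξ x) - I * ε ^ 3 * (bc a ε 4 x * w a 2 ε ξ x)
  + ε ^ 3 * (bc a ε 5 x * w a 3 ε ξ x)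

/-- The quantity `Q₂²`. -/
def q22 (a : ℝ → ℝ) (ε ξ x : ℝ) : ℂ :=
  -(I * ε) * ((x - ξ : ℝ) * ((((b a x * bc a ε 0 x : ℝ) : ℂ) + (b a ξ * bc a ε 0 ξ : ℝ)) / 2))
  - ε * bc a ε 0 ξ * (bc a ε 0 x * v a 1 ε ξ x)
  + I * ε * (bc a ε 1 x * (bc a ε 0 ξ - bc a ε 0 x) * v a 2 ε ξ x)

/-- The quantity `Q₂³` with integrals `G₀` and `G₁` instead of Simpson's rule. -/
def q23 (a : ℝ → ℝ) (G₀ G₁ : ℂ) (ε ξ x : ℝ) : ℂ :=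
  -(I * ε) * G₀ - ε ^ 2 * (bc a ε 0 ξ * (bc a ε 0 x * v a 0 ε ξ x - bc a ε 0 ξ) - G₁)
  + I * ε ^ 2 * ((bc a ε 0 ξ * bc a ε 1 x - bc a ε 1 ξ * bc a ε 0 x) * v a 1 ε ξ x)
  + ε ^ 2 * (((bc a ε 0 ξ + bc a ε 0 x) * bc a ε 2 x - bc a ε 1 ξ * bc a ε 1 x
    - 2 * (bc a ε 0 x * bc a ε 3 x * s a ε x ξ)) * v a 2 ε ξ x)
  + I * ε ^ 2 * (((bc a ε 0 x - bc a ε 0 ξ) * bc a ε 3 x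
    - (bc a ε 1 x - bc a ε 1 ξ) * bc a ε 2 x) * v a 3 ε ξ x)

/-- The quantity `Q₃³ / E(ξ)` without the terms that contain `l₀ - b₀(ξ) κ₀`. -/
def q33 (a : ℝ → ℝ) (ε ξ x : ℝ) : ℂ :=
  -(ε / 2) * ((x - ξ : ℝ) * (c0 a ε x + b a ξ * bc a ε 0 ξ * bc a ε 0 x) * w a 1 ε ξ x)
  - I * ε * ((1 / 2 * ((x - ξ : ℝ) * (c1 a ε x + b a ξ * bc a ε 0 ξ * bc a ε 1 x)
      + (d0 a ε x + b a ξ * bc a ε 0 ξ * f0 a ε x)) + bc a ε 0 ξ * (bc a ε 0 x : ℂ) ^ 2)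
      * w a 2 ε ξ x)
  + ε * ((1 / 2 * (e0 a ε x + d1 a ε x + b a ξ * bc a ε 0 ξ * (g0 a ε x + f1 a ε x))
      + 2 * (bc a ε 0 ξ * (bc a ε 0 x * bc a ε 1 x))) * w a 3 ε ξ x)

section estimates

variable (H : Admissible a ε₀) {m₁ m₂ m₃ : ℝ → ℝ → ℝ → ℂ} (hm : Picard a ε₀ m₁ m₂ m₃)
include H hm

/-- After differentiation the b₀ terms cancel b w₀, the b₁ terms cancel each other, and only
−2εφ'b₂w₁ remains. This coarse version is what m₂ needs for WKB2. -/
theorem picard_one_sub_q11 : OO ε₀ 1 2 (fun ε ξ x => m₁ ε ξ x - q11 a ε ξ x) := by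
  have hR : OO ε₀ 1 1 (fun ε ξ x => (ε : ℂ) ^ 1 * (-2 * (phaseDeriv a ε x : ℂ) *
      (bc a ε 2 x * w a 1 ε ξ x))) :=
    OO.eps_mul 1 (((H.smooth_phaseDeriv.OO_right.smul (-2)).bdd_mul
      ((H.smooth_bc 2).OO_right.bdd_mul (OO_w H 1))))
  refine hR.integrate (fun ε ξ d => by simp [q11, hm.zero₁ ε ξ d, w_self, w_zero_self])
    fun ε ξ x d => ?_
  have B := fun p => hasDeriv_bc H p d
  have hne := d.ne
  refine ((hm.deriv₁ ε ξ x d).sub (((((B 0).mul (hasDeriv_w_zero H d)).sub_const _).const_mul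
    (-(I * ε))).add (((B 1).mul (hasDeriv_w H 0 d)).const_mul (ε : ℂ)))).congr_deriv ?_
  have hI := Complex.I_sq
  rw [b_eq H d]
  field_simp
  ring_nf
  grind

/-- The same telescoping carried two terms further leaves 2ε²φ'b₄w₂. -/
theorem picard_one_sub_q12 : OO ε₀ 2 3 (fun ε ξ x => m₁ ε ξ x - q12 a ε ξ x) := by
  have hR : OO ε₀ 2 2 (fun ε ξ x => (ε : ℂ) ^ 2 * (2 * (phaseDeriv a ε x : ℂ) *
      (bc a ε 4 x * w a 2 ε ξ x))) :=
    OO.eps_mul 2 (((H.smooth_phaseDeriv.OO_right.smul 2).bdd_mul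
      ((H.smooth_bc 4).OO_right.bdd_mul (OO_w H 2))))
  refine hR.integrate (fun ε ξ d => by simp [q12, hm.zero₁ ε ξ d, w_self, w_zero_self])
    fun ε ξ x d => ?_
  have B := fun p => hasDeriv_bc H p d
  have W0 := hasDeriv_w_zero H d
  have W := fun p => hasDeriv_w H p d
  have hne := d.ne
  refine ((hm.deriv₁ ε ξ x d).sub (((((((B 0).mul W0).sub_const _).const_mul
    (-(I * ε))).add ((((B 1).mul W0).sub_const _).const_mul ((ε : ℂ) ^ 2))).add
    (((B 2).mul (W 0)).const_mul (I * ε ^ 2))).sub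
    (((B 3).mul (W 1)).const_mul ((ε : ℂ) ^ 2)))).congr_deriv ?_
  have hI := Complex.I_sq
  rw [b_eq H d]
  field_simp
  ring_nf
  grind

/-- Here the telescoping leaves −2ε³φ'b₆w₃. -/
theorem picard_one_sub_q13 : OO ε₀ 3 4 (fun ε ξ x => m₁ ε ξ x - q13 a ε ξ x) := by
  have hR : OO ε₀ 3 3 (fun ε ξ x => (ε : ℂ) ^ 3 * (-2 * (phaseDeriv a ε x : ℂ) *
      (bc a ε 6 x * w a 3 ε ξ x))) :=
    OO.eps_mul 3 (((H.smooth_phaseDeriv.OO_right.smul (-2)).bdd_mul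
      ((H.smooth_bc 6).OO_right.bdd_mul (OO_w H 3))))
  refine hR.integrate (fun ε ξ d => by simp [q13, hm.zero₁ ε ξ d, w_self, w_zero_self])
    fun ε ξ x d => ?_
  have B := fun p => hasDeriv_bc H p d
  have W0 := hasDeriv_w_zero H d
  have W := fun p => hasDeriv_w H p d
  have hne := d.ne
  refine ((hm.deriv₁ ε ξ x d).sub (((((((((B 0).mul W0).sub_const _).const_mul
    (-(I * ε))).add ((((B 1).mul W0).sub_const _).const_mul ((ε : ℂ) ^ 2))).add
    ((((B 2).mul W0).sub_const _).const_mul (I * ε ^ 3))).sub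
    (((B 3).mul (W 0)).const_mul ((ε : ℂ) ^ 3))).sub
    (((B 4).mul (W 1)).const_mul (I * ε ^ 3))).add
    (((B 5).mul (W 2)).const_mul ((ε : ℂ) ^ 3)))).congr_deriv ?_
  have hI := Complex.I_sq
  rw [b_eq H d]
  field_simp
  ring_nf
  grind

/-- In m₂' = b v₀ m₁ the factor m₁ is replaced by `q11`. Since v₀w₀ = 1, the product contains the
non-oscillating term −iεbb₀, which the trapezoidal rule integrates; the other terms telescope
through v₁ and v₂. -/
theorem picard_two_sub_q22 : OO ε₀ 1 3 (fun ε ξ x => m₂ ε ξ x - q22 a ε ξ x) := by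
  have hF := H.smooth_b.mul (H.smooth_bc 0)
  have B := fun p => (H.smooth_bc p).OO_right
  have hR := ((H.smooth_b.OO_right.mul (OO_v H 0)).bdd_mul (picard_one_sub_q11 H hm)).add
    (OO.eps_mul 1 (((OO_trapezoid_deriv hF).smul (I / 2)).add
      ((H.smooth_phaseDeriv.OO_right.smul (-2 * I)).bdd_mul
      ((((B 2).mul (((H.smooth_bc 0).OO_sub.mono le_rfl zero_le_one).smul (-1))).add
        ((B 1).mul ((B 1).smul (-1)))).bdd_mul (OO_v H 2)))))
  refine hR.integrate (fun ε ξ d => by simp [q22, hm.zero₂ ε ξ d, v_self]) fun ε ξ x d => ?_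
  have B := fun p => hasDeriv_bc H p d
  have V := fun p => hasDeriv_v H p d
  have hne := d.ne
  refine ((hm.deriv₂ ε ξ x d).sub (((((hasDeriv_step ξ x).mul
    (((hF.hasDeriv d).add_const _).div_const 2)).const_mul (-(I * ε))).sub
    (((B 0).mul (V 0)).const_mul (ε * bc a ε 0 ξ : ℂ))).add
    ((((B 1).mul ((B 0).const_sub (bc a ε 0 ξ : ℂ))).mul (V 1)).const_mul
      (I * ε)))).congr_deriv ?_
  have hI := Complex.I_sq
  have hvw := v_mul_w a ε ξ x
  rw [q11, w_one, v_one]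
  push_cast
  rw [b_eq H d]
  simp only [Pi.mul_apply]
  grind

/-- Now `q12` replaces m₁ and the non-oscillating integrals of bb₀ and bb₁ are kept exact. Simpson's
rule enters separately, because its error carries a different balance of ε and step size. -/
theorem picard_two_sub_q23 : OO ε₀ 2 4 (fun ε ξ x => m₂ ε ξ x -
    q23 a ((∫ τ in (0 : ℝ)..x, b a τ * bc a ε 0 τ : ℝ) - (∫ τ in (0 : ℝ)..ξ, b a τ * bc a ε 0 τ : ℝ))
      ((∫ τ in (0 : ℝ)..x, b a τ * bc a ε 1 τ : ℝ) - (∫ τ in (0 : ℝ)..ξ, b a τ * bc a ε 1 τ : ℝ))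
      ε ξ x) := by
  have hF := fun p => H.smooth_b.mul (H.smooth_bc p)
  have B := fun p => (H.smooth_bc p).OO_right
  have Bl := fun p => (H.smooth_bc p).OO_left
  have hφ := H.smooth_phaseDeriv.OO_right
  have hR := ((H.smooth_b.OO_right.mul (OO_v H 0)).bdd_mul (picard_one_sub_q12 H hm)).add
    (OO.eps_mul 2 (((hφ.smul 4).bdd_mul ((((B 1).mul (B 3)).add ((B 0).mul (B 4))).bdd_mul
      ((OO_s H).mul (OO_v H 2)))).add
      ((hφ.smul (-2 * I)).bdd_mul ((((((B 0).add ((Bl 0).smul (-1))).mul (B 4)).add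
        ((B 2).mul ((B 2).smul (-1)))).add ((Bl 1).mul (B 3))).bdd_mul (OO_v H 3)))))
  refine hR.integrate (fun ε ξ d => by simp [q23, hm.zero₂ ε ξ d, v_self, v_zero_self])
    fun ε ξ x d => ?_
  have B := fun p => hasDeriv_bc H p d
  have V0 := hasDeriv_v_zero H d
  have V := fun p => hasDeriv_v H p d
  have S := hasDeriv_s H d
  have G := fun p => ((hasDerivWithinAt_integral
    ((hF p).differentiableOn d.pos d.le).continuousOn d.mem).ofReal_comp.sub_const
      ((∫ τ in (0 : ℝ)..ξ, b a τ * bc a ε p τ : ℝ) : ℂ))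
  have hne := d.ne
  refine ((hm.deriv₂ ε ξ x d).sub (((((((G 0).const_mul (-(I * ε))).sub
    ((((((B 0).mul V0).sub_const _).const_mul (bc a ε 0 ξ : ℂ)).sub (G 1)).const_mul
      ((ε : ℂ) ^ 2))).add
    (((((B 1).const_mul _).sub ((B 0).const_mul _)).mul (V 0)).const_mul (I * ε ^ 2))).add
    (((((((B 0).const_add _).mul (B 2)).sub ((B 1).const_mul _)).sub
      ((((B 0).mul (B 3)).mul S).const_mul 2)).mul (V 1)).const_mul ((ε : ℂ) ^ 2))).add
    ((((((B 0).sub_const _).mul (B 3)).sub (((B 1).sub_const _).mul (B 2))).mul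
      (V 2)).const_mul (I * ε ^ 2))))).congr_deriv ?_
  have hI := Complex.I_sq
  have hvw := v_mul_w a ε ξ x
  rw [q12, w_two d, w_one, v_two d, v_one]
  push_cast
  rw [b_eq H d]
  simp only [Pi.mul_apply, Pi.sub_apply]
  field_simp
  grind

/-- In m₃' = b w₀ m₂ the factor m₂ is replaced by `q22`. There w₀v₁ = −w₁, and the trapezoidal term
times w₀ is integrated by parts into w₁, w₂ and w₃. -/
theorem picard_three_sub_q33 : OO ε₀ 1 4 (fun ε ξ x => m₃ ε ξ x - q33 a ε ξ x) := by
  have B := fun p => (H.smooth_bc p).OO_right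
  have Bl := fun p => (H.smooth_bc p).OO_left
  have hb := H.smooth_b.OO_right
  have hβ := H.smooth_b.OO_left.mul (Bl 0)
  have hφ := H.smooth_phaseDeriv.OO_right
  have hR := ((hb.mul (OO_w H 0)).bdd_mul (picard_two_sub_q22 H hm)).add
    (OO.eps_mul 1 (((((hb.mul (B 1)).smul (-I)).mul ((H.smooth_bc 0).OO_sub.mul
      ((OO_w H 0).mul (OO_v H 2)))).add
      (OO.step.mul (((H.smooth_c1.derivD.OO_right.add (hβ.mul (hφ.mul ((B 2).smul 2)))).smul
        (I / 2)).bdd_mul (OO_w H 2)))).add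
      (((((H.smooth_e0.derivD.OO_right.add H.smooth_d1.derivD.OO_right).add
        (hβ.mul (H.smooth_g0.derivD.OO_right.add H.smooth_f1.derivD.OO_right))).smul (-1 / 2)).add
        (((Bl 0).mul (hφ.mul (((B 1).mul (B 1)).add ((B 0).mul (B 2))))).smul
          (-4))).bdd_mul (OO_w H 3))))
  refine hR.integrate (fun ε ξ d => by simp [q33, hm.zero₃ ε ξ d, w_self]) fun ε ξ x d => ?_
  have B := fun p => hasDeriv_bc H p d
  have W := fun p => hasDeriv_w H p d
  have T := hasDeriv_step ξ x
  have hne := d.ne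
  refine ((hm.deriv₃ ε ξ x d).sub (((((T.mul ((H.smooth_c0.hasDeriv d).add
    ((B 0).const_mul _))).mul (W 0)).const_mul (-(ε / 2) : ℂ)).sub
    (((((T.mul ((H.smooth_c1.hasDeriv d).add ((B 1).const_mul _))).add
      ((H.smooth_d0.hasDeriv d).add ((H.smooth_f0.hasDeriv d).const_mul _))).const_mul
      (1 / 2)).add ((hasDeriv_bc_sq H d).const_mul _)|>.mul (W 1)).const_mul (I * ε))).add
    ((((((H.smooth_e0.hasDeriv d).add (H.smooth_d1.hasDeriv d)).add
      (((H.smooth_g0.hasDeriv d).add (H.smooth_f1.hasDeriv d)).const_mul _)).const_mul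
      (1 / 2)).add ((((B 0).mul (B 1)).const_mul _).const_mul 2)|>.mul
      (W 2)).const_mul (ε : ℂ)))).congr_deriv ?_
  have hI := Complex.I_sq
  have hvw := v_mul_w a ε ξ x
  have hc0 : ((b a x ^ 2 * bc a ε 0 x : ℝ) : ℂ) = _ := eq_of_div H d (y := c0 a ε x) rfl
  have hc1 := eq_of_div H d (y := c1 a ε x) rfl
  have hd0 := eq_of_div H d (y := d0 a ε x) rfl
  have hd1 := eq_of_div H d (y := d1 a ε x) rfl
  have he0 := eq_of_div H d (y := e0 a ε x) rfl
  have hf0 := eq_of_div H d (y := f0 a ε x) rfl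
  have hf1 := eq_of_div H d (y := f1 a ε x) rfl
  have hg0 := eq_of_div H d (y := g0 a ε x) rfl
  have hb := b_eq H d
  -- Once w₁, w₂, v₁, v₂ are expressed by w₀, v₀ and s, the claim is polynomial modulo v₀w₀ = 1, I²
  -- = −1 and the relations defining the coefficients.
  rw [q22, w_two d, w_one, v_two d, v_one]
  push_cast at hc0 ⊢
  simp only [Pi.mul_apply, Pi.add_apply]
  grind

end estimates

end

section

open Complex (I)

variable {a : ℝ → ℝ} {ε₀ ε ξ x : ℝ}

/-! ### Errors of the approximations `Q` -/

theorem osc_eq (a : ℝ → ℝ) (ε ξ x : ℝ) : osc a ε x = osc a ε ξ * w a 0 ε ξ x := by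
  rw [w_zero, osc, osc, ← Complex.exp_add]
  congr 1
  simp only [s]
  push_cast
  ring

theorem osc_ne_zero (a : ℝ → ℝ) (ε x : ℝ) : osc a ε x ≠ 0 := Complex.exp_ne_zero _

theorem norm_osc (a : ℝ → ℝ) (ε x : ℝ) : ‖osc a ε x‖ = 1 := by
  have h : osc a ε x = Complex.exp (((2 / ε * phase a ε x : ℝ) : ℂ) * I) := by
    rw [osc]
    congr 1
    push_cast
    ring
  rw [h, Complex.norm_exp_ofReal_mul_I]

theorem osc_mul_conj (a : ℝ → ℝ) (ε x : ℝ) : osc a ε x * starRingEnd ℂ (osc a ε x) = 1 := by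
  rw [Complex.mul_conj, Complex.normSq_eq_norm_sq, norm_osc]
  simp

theorem osc_mul_inv (a : ℝ → ℝ) (ε ξ x : ℝ) : osc a ε ξ * (osc a ε x)⁻¹ = v a 0 ε ξ x := by
  have := osc_ne_zero a ε x
  have h := v_mul_w a ε ξ x
  rw [← div_eq_mul_inv, div_eq_iff this, osc_eq a ε ξ x, ← mul_assoc, mul_comm _ (osc a ε ξ),
    mul_assoc, h, mul_one]

theorem Q1_two_eq (a : ℝ → ℝ) (ε ξ x : ℝ) : Q1 a ε 2 x ξ = osc a ε ξ * q12 a ε ξ x := by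
  have hI := Complex.I_sq
  simp only [Q1, q12, w, Finset.sum_Icc_succ_top, Nat.reduceLeDiff, Finset.Icc_self,
    Finset.sum_singleton, Nat.reduceAdd, Nat.reduceSub, osc_eq a ε ξ x]
  grind

theorem Q1_three_eq (a : ℝ → ℝ) (ε ξ x : ℝ) : Q1 a ε 3 x ξ = osc a ε ξ * q13 a ε ξ x := by
  have hI := Complex.I_sq
  simp only [Q1, q13, w, Finset.sum_Icc_succ_top, Nat.reduceLeDiff, Finset.Icc_self,
    Finset.sum_singleton, Nat.reduceAdd, Nat.reduceSub, osc_eq a ε ξ x]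
  grind

theorem Q22_eq (a : ℝ → ℝ) (ε ξ x : ℝ) : Q22 a ε x ξ = q22 a ε ξ x := by
  simp only [Q22, q22, v]
  push_cast
  ring

theorem Q23_eq (a : ℝ → ℝ) (ε ξ x : ℝ) : Q23 a ε x ξ =
    q23 a (simpson (fun y => b a y * bc a ε 0 y) x ξ) (simpson (fun y => b a y * bc a ε 1 y) x ξ)
      ε ξ x := by
  have h1 := osc_mul_inv a ε ξ x
  have h2 : osc a ε ξ * (osc a ε ξ)⁻¹ = 1 := mul_inv_cancel₀ (osc_ne_zero a ε ξ)
  simp only [Q23, q23]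
  rw [← h1]
  simp only [v]
  generalize ((simpson (fun y => b a y * bc a ε 0 y) x ξ : ℝ) : ℂ) = S₀
  generalize ((simpson (fun y => b a y * bc a ε 1 y) x ξ : ℝ) : ℂ) = S₁
  linear_combination (ε ^ 2 * bc a ε 0 ξ ^ 2 : ℂ) * h2

theorem Q33_eq (d : Dom ε₀ ε ξ x) : Q33 a ε x ξ = osc a ε ξ * (q33 a ε ξ x +
    (l0 a ε x - bc a ε 0 ξ * κ0 a ε x) *
      (2 * ε * w a 3 ε ξ x - 2 * I * ε * (s a ε x ξ * w a 2 ε ξ x))) := by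
  have := d.ne
  simp only [Q33, q33, w]
  push_cast
  ring

section estimates

variable (H : Admissible a ε₀) {m₁ m₂ m₃ : ℝ → ℝ → ℝ → ℂ} (hm : Picard a ε₀ m₁ m₂ m₃)

theorem OO_osc : OO ε₀ 0 0 (fun ε ξ _ => osc a ε ξ) :=
  ⟨1, zero_le_one, fun ε ξ x _ => by simp [norm_osc]⟩

theorem OO_simpson {F : ℝ → ℝ → ℝ} (hF : SmoothFamily ε₀ F) :
    OO ε₀ 0 5 (fun ε ξ x => ((simpson (F ε) x ξ : ℝ) : ℂ) -
      (((∫ τ in (0 : ℝ)..x, F ε τ : ℝ) : ℂ) - (∫ τ in (0 : ℝ)..ξ, F ε τ : ℝ))) := by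
  refine (OO_simpson_deriv hF).integrate (fun ε ξ d => by simp [simpson]) fun ε ξ x d => ?_
  have hs : (fun y : ℝ => ((simpson (F ε) y ξ : ℝ) : ℂ)) = fun y : ℝ => ((y - ξ : ℝ) : ℂ) *
      (((F ε ξ : ℂ) + 4 * F ε ((ξ + y) / 2) + F ε y) / 6) := by
    funext y
    simp only [simpson]
    push_cast
    ring
  have h1 := ((hasDeriv_step ξ x).mul
    (((((hF.hasDeriv_mid d).const_mul 4).const_add (F ε ξ : ℂ)).add
      (hF.hasDeriv d)).div_const 6)).congr (fun y _ => congrFun hs y) (congrFun hs x)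
  refine (h1.sub ((hasDerivWithinAt_integral
    (hF.differentiableOn d.pos d.le).continuousOn d.mem).ofReal_comp.sub_const _)).congr_deriv ?_
  simp only [Pi.add_apply]
  ring

include H hm

theorem OO_Q1_two : OO ε₀ 2 3 (fun ε ξ x => osc a ε ξ * m₁ ε ξ x - Q1 a ε 2 x ξ) :=
  (OO_osc.bdd_mul (picard_one_sub_q12 H hm)).congr fun ε ξ x _ => by rw [Q1_two_eq]; ring

theorem OO_Q1_three : OO ε₀ 3 4 (fun ε ξ x => osc a ε ξ * m₁ ε ξ x - Q1 a ε 3 x ξ) :=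
  (OO_osc.bdd_mul (picard_one_sub_q13 H hm)).congr fun ε ξ x _ => by rw [Q1_three_eq]; ring

theorem OO_Q22 : OO ε₀ 1 3 (fun ε ξ x => m₂ ε ξ x - Q22 a ε x ξ) :=
  (picard_two_sub_q22 H hm).congr fun ε ξ x _ => by rw [Q22_eq]

/-- The remainder `r` collects the two Simpson errors, of sizes ε(x−ξ)⁵ and ε²(x−ξ)⁵. The first has
too few powers of ε to be merged with the rest. -/
theorem OO_Q23 : ∃ r : ℝ → ℝ → ℝ → ℂ, OO ε₀ 1 5 r ∧
    OO ε₀ 2 4 (fun ε ξ x => m₂ ε ξ x - Q23 a ε x ξ - r ε ξ x) := by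
  have h := fun p => OO_simpson (H.smooth_b.mul (H.smooth_bc p))
  refine ⟨_, (OO.eps_mul 1 ((h 0).smul I)).add ((OO.eps_mul 2 ((h 1).smul (-1))).mono
    one_le_two le_rfl), (picard_two_sub_q23 H hm).congr fun ε ξ x d => ?_⟩
  rw [Q23_eq]
  simp only [q23]
  ring

/-- The terms of Q₃³ missing from `q33` carry l₀ − b₀(ξ)κ₀ = κ₀(b₀(x) − b₀(ξ)) = O(x − ξ), times
O(ε(x−ξ)³), so they do not affect the order. -/
theorem OO_Q33 : OO ε₀ 1 4 (fun ε ξ x => osc a ε ξ * m₃ ε ξ x - Q33 a ε x ξ) := by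
  have h := (OO_osc (a := a) (ε₀ := ε₀)).bdd_mul ((picard_three_sub_q33 H hm).add
    (OO.eps_mul 1 ((((H.smooth_κ0.OO_right.mul (H.smooth_bc 0).OO_sub).mul
      (((OO_w H 3).smul (-2)).add (((OO_s H).mul (OO_w H 2)).smul (2 * I)))).mono le_rfl
        le_rfl : OO ε₀ 0 4 _))))
  refine h.congr fun ε ξ x d => ?_
  have hl : (l0 a ε x : ℂ) = κ0 a ε x * bc a ε 0 x := by
    simp only [l0, κ0]
    push_cast
    ring
  rw [Q33_eq d, hl]
  ring

end estimates

/-! ### The system for `Z` -/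

/-- The pair `(z₁, z₂)` solves `Z' = ε N Z`. -/
structure IsPair (a : ℝ → ℝ) (ε : ℝ) (z₁ z₂ : ℝ → ℂ) : Prop where
  deriv₁ : ∀ x ∈ Set.Icc (0 : ℝ) 1, HasDerivWithinAt z₁
    (ε * b a x * starRingEnd ℂ (osc a ε x) * z₂ x) (Set.Icc 0 1) x
  deriv₂ : ∀ x ∈ Set.Icc (0 : ℝ) 1, HasDerivWithinAt z₂
    (ε * b a x * osc a ε x * z₁ x) (Set.Icc 0 1) x

theorem hasDeriv_conj {f : ℝ → ℂ} {f' : ℂ} {S : Set ℝ} (h : HasDerivWithinAt f f' S x) :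
    HasDerivWithinAt (fun y => starRingEnd ℂ (f y)) (starRingEnd ℂ f') S x :=
  (Complex.conjCLE.toContinuousLinearMap.hasFDerivAt.comp_hasDerivWithinAt x h)

/-- The system is invariant under conjugating and swapping the components, so every estimate is
needed for the second component only. -/
theorem IsPair.symm {z₁ z₂ : ℝ → ℂ} (h : IsPair a ε z₁ z₂) :
    IsPair a ε (fun x => starRingEnd ℂ (z₂ x)) (fun x => starRingEnd ℂ (z₁ x)) :=
  ⟨fun x hx => (hasDeriv_conj (h.deriv₂ x hx)).congr_deriv (by simp),
    fun x hx => (hasDeriv_conj (h.deriv₁ x hx)).congr_deriv (by simp)⟩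

theorem norm_le_of_deriv {f f' : ℝ → ℂ} {C : ℝ} {k : ℕ} (hC : 0 ≤ C) (h0 : f ξ = 0)
    (hξ : 0 ≤ ξ) (hξx : ξ ≤ x) (hx : x ≤ 1)
    (hd : ∀ y ∈ Set.Icc ξ x, HasDerivWithinAt f (f' y) (Set.Icc 0 1) y)
    (hb : ∀ y ∈ Set.Icc ξ x, ‖f' y‖ ≤ C * (y - ξ) ^ k) : ‖f x‖ ≤ C * (x - ξ) ^ (k + 1) := by
  have h := (convex_Icc ξ x).norm_image_sub_le_of_norm_hasDerivWithin_le
    (f := f) (f' := f') (C := C * (x - ξ) ^ k) (x := ξ) (y := x)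
    (fun y hy => (hd y hy).mono (Set.Icc_subset_Icc hξ hx))
    (fun y hy => (hb y hy).trans (by
      have h1 : 0 ≤ y - ξ := sub_nonneg.2 hy.1
      have h2 : y - ξ ≤ x - ξ := by linarith [hy.2]
      gcongr)) ⟨le_rfl, hξx⟩ ⟨hξx, le_rfl⟩
  rw [h0, sub_zero, Real.norm_of_nonneg (sub_nonneg.2 hξx)] at h
  refine h.trans (le_of_eq ?_)
  ring

/-! ### Remainders of the truncated Picard expansion -/

section local_error

variable {z₁ z₂ : ℝ → ℂ} {B R : ℝ}

theorem norm_coeff_mul_le (hB : ∀ x ∈ Set.Icc (0 : ℝ) 1, |b a x| ≤ B) (h0 : 0 < ε)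
    (hx : x ∈ Set.Icc (0 : ℝ) 1) {z : ℂ} {K : ℝ} (hz : ‖z‖ ≤ K) :
    ‖(ε : ℂ) * b a x * osc a ε x * z‖ ≤ ε * B * K := by
  rw [norm_mul, norm_mul, norm_mul, norm_osc, Complex.norm_real, Complex.norm_real, mul_one,
    Real.norm_of_nonneg h0.le, Real.norm_eq_abs]
  have h1 := hB x hx
  have h2 := (abs_nonneg _).trans h1
  gcongr

variable (hB : ∀ x ∈ Set.Icc (0 : ℝ) 1, |b a x| ≤ B) (d : Dom ε₀ ε ξ x)
  (hR₁ : ∀ x ∈ Set.Icc (0 : ℝ) 1, ‖z₁ x‖ ≤ R) (hR₂ : ∀ x ∈ Set.Icc (0 : ℝ) 1, ‖z₂ x‖ ≤ R)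
  (hz : IsPair a ε z₁ z₂)

theorem Dom.of_mem (d : Dom ε₀ ε ξ x) {y : ℝ} (hy : y ∈ Set.Icc ξ x) : Dom ε₀ ε ξ y :=
  ⟨d.pos, d.le, d.le_one, d.nonneg, hy.1, hy.2.trans d.right⟩

include hB d hR₁ hz in
theorem IsPair.taylor_zero : ‖z₂ x - z₂ ξ‖ ≤ R * (B * ε * (x - ξ)) := by
  have h0 : 0 ≤ B := (abs_nonneg _).trans (hB x d.mem)
  have h1 : 0 ≤ R := (norm_nonneg _).trans (hR₁ x d.mem)
  have h2 := d.pos.le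
  have h := norm_le_of_deriv (k := 0) (f := fun y => z₂ y - z₂ ξ) (C := ε * B * R)
    (by positivity) (sub_self _) d.nonneg d.ordered d.right
    (fun y hy => (hz.deriv₂ y (d.of_mem hy).mem).sub_const _) fun y hy => by
      rw [pow_zero, mul_one]
      exact norm_coeff_mul_le hB d.pos (d.of_mem hy).mem (hR₁ y (d.of_mem hy).mem)
  exact h.trans (le_of_eq (by ring))

variable {m₁ m₂ m₃ : ℝ → ℝ → ℝ → ℂ} (hm : Picard a ε₀ m₁ m₂ m₃)

include hm in
theorem Picard.deriv_osc_mul (d : Dom ε₀ ε ξ x) :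
    HasDerivWithinAt (fun y => osc a ε ξ * m₁ ε ξ y) (b a x * osc a ε x) (Set.Icc 0 1) x :=
  ((hm.deriv₁ ε ξ x d).const_mul _).congr_deriv (by rw [osc_eq a ε ξ x]; ring)

include hm in
theorem Picard.deriv_conj_two (d : Dom ε₀ ε ξ x) :
    HasDerivWithinAt (fun y => starRingEnd ℂ (m₂ ε ξ y))
      (b a x * osc a ε x * starRingEnd ℂ (osc a ε ξ * m₁ ε ξ x)) (Set.Icc 0 1) x := by
  refine (hasDeriv_conj (hm.deriv₂ ε ξ x d)).congr_deriv ?_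
  have h2 : (starRingEnd ℂ) (osc a ε x)⁻¹ = osc a ε x := by
    rw [inv_eq_of_mul_eq_one_right (osc_mul_conj a ε x), Complex.conj_conj]
  rw [← osc_mul_inv]
  simp only [map_mul, Complex.conj_ofReal, h2]
  ring

include hm in
theorem Picard.deriv_osc_mul_three (d : Dom ε₀ ε ξ x) :
    HasDerivWithinAt (fun y => osc a ε ξ * m₃ ε ξ y) (b a x * osc a ε x * m₂ ε ξ x)
      (Set.Icc 0 1) x :=
  ((hm.deriv₃ ε ξ x d).const_mul _).congr_deriv (by rw [osc_eq a ε ξ x]; ring)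

include hB d hR₂ hz hm in
-- The derivative of this remainder is εbE times the preceding remainder for z₁, which `IsPair.symm`
-- supplies. Each such integration contributes a factor Bε(x − ξ); the next two lemmas repeat the
-- argument.
theorem IsPair.taylor_one :
    ‖z₂ x - z₂ ξ - ε * (osc a ε ξ * m₁ ε ξ x) * z₁ ξ‖ ≤ R * (B * ε * (x - ξ)) ^ 2 := by
  have h0 : 0 ≤ B := (abs_nonneg _).trans (hB x d.mem)
  have h1 : 0 ≤ R := (norm_nonneg _).trans (hR₂ x d.mem)
  have h2 := d.pos.le
  have h := norm_le_of_deriv (k := 1)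
    (f := fun y => z₂ y - z₂ ξ - ε * (osc a ε ξ * m₁ ε ξ y) * z₁ ξ)
    (f' := fun y => ε * b a y * osc a ε y * (z₁ y - z₁ ξ)) (C := ε * B * (R * B * ε))
    (by positivity) (by simp [hm.zero₁ ε ξ d.left]) d.nonneg d.ordered d.right
    (fun y hy => (((hz.deriv₂ y (d.of_mem hy).mem).sub_const _).sub
      (((hm.deriv_osc_mul (d.of_mem hy)).const_mul _).mul_const _)).congr_deriv (by ring))
    fun y hy => by
      have h3 := IsPair.taylor_zero hB (d.of_mem hy) (R := R) (by simpa using hR₂) hz.symm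
      simp only [← map_sub, Complex.norm_conj] at h3
      refine (norm_coeff_mul_le hB d.pos (d.of_mem hy).mem h3).trans (le_of_eq (by ring))
  exact h.trans (le_of_eq (by ring))

include hB d hR₁ hz hm in
theorem IsPair.taylor_two :
    ‖z₂ x - z₂ ξ - ε * (osc a ε ξ * m₁ ε ξ x) * z₁ ξ
      - ε ^ 2 * starRingEnd ℂ (m₂ ε ξ x) * z₂ ξ‖ ≤ R * (B * ε * (x - ξ)) ^ 3 := by
  have h0 : 0 ≤ B := (abs_nonneg _).trans (hB x d.mem)
  have h1 : 0 ≤ R := (norm_nonneg _).trans (hR₁ x d.mem)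
  have h2 := d.pos.le
  have h := norm_le_of_deriv (k := 2)
    (f := fun y => z₂ y - z₂ ξ - ε * (osc a ε ξ * m₁ ε ξ y) * z₁ ξ
      - ε ^ 2 * starRingEnd ℂ (m₂ ε ξ y) * z₂ ξ)
    (f' := fun y => ε * b a y * osc a ε y *
      (z₁ y - z₁ ξ - ε * starRingEnd ℂ (osc a ε ξ * m₁ ε ξ y) * z₂ ξ))
    (C := ε * B * (R * (B * ε) ^ 2))
    (by positivity) (by simp [hm.zero₁ ε ξ d.left, hm.zero₂ ε ξ d.left]) d.nonneg d.ordered d.right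
    (fun y hy => ((((hz.deriv₂ y (d.of_mem hy).mem).sub_const _).sub
      (((hm.deriv_osc_mul (d.of_mem hy)).const_mul _).mul_const _)).sub
      (((hm.deriv_conj_two (d.of_mem hy)).const_mul _).mul_const _)).congr_deriv (by ring))
    fun y hy => by
      have h3 := IsPair.taylor_one hB (d.of_mem hy) (R := R) (by simpa using hR₁) hz.symm hm
      rw [← Complex.norm_conj] at h3
      simp only [map_sub, map_mul, Complex.conj_conj, Complex.conj_ofReal] at h3
      simp only [map_mul]
      refine (norm_coeff_mul_le hB d.pos (d.of_mem hy).mem h3).trans (le_of_eq (by ring))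
  exact h.trans (le_of_eq (by ring))

include hB d hR₂ hz hm in
theorem IsPair.taylor_three :
    ‖z₂ x - z₂ ξ - ε * (osc a ε ξ * m₁ ε ξ x) * z₁ ξ
      - ε ^ 2 * starRingEnd ℂ (m₂ ε ξ x) * z₂ ξ - ε ^ 3 * (osc a ε ξ * m₃ ε ξ x) * z₁ ξ‖
      ≤ R * (B * ε * (x - ξ)) ^ 4 := by
  have h0 : 0 ≤ B := (abs_nonneg _).trans (hB x d.mem)
  have h1 : 0 ≤ R := (norm_nonneg _).trans (hR₂ x d.mem)
  have h2 := d.pos.le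
  have h := norm_le_of_deriv (k := 3)
    (f := fun y => z₂ y - z₂ ξ - ε * (osc a ε ξ * m₁ ε ξ y) * z₁ ξ
      - ε ^ 2 * starRingEnd ℂ (m₂ ε ξ y) * z₂ ξ - ε ^ 3 * (osc a ε ξ * m₃ ε ξ y) * z₁ ξ)
    (f' := fun y => ε * b a y * osc a ε y *
      (z₁ y - z₁ ξ - ε * starRingEnd ℂ (osc a ε ξ * m₁ ε ξ y) * z₂ ξ
        - ε ^ 2 * m₂ ε ξ y * z₁ ξ))
    (C := ε * B * (R * (B * ε) ^ 3))
    (by positivity) (by simp [hm.zero₁ ε ξ d.left, hm.zero₂ ε ξ d.left, hm.zero₃ ε ξ d.left])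
    d.nonneg d.ordered d.right
    (fun y hy => (((((hz.deriv₂ y (d.of_mem hy).mem).sub_const _).sub
      (((hm.deriv_osc_mul (d.of_mem hy)).const_mul _).mul_const _)).sub
      (((hm.deriv_conj_two (d.of_mem hy)).const_mul _).mul_const _)).sub
      (((hm.deriv_osc_mul_three (d.of_mem hy)).const_mul _).mul_const _)).congr_deriv (by ring))
    fun y hy => by
      have h3 := IsPair.taylor_two hB (d.of_mem hy) (R := R) (by simpa using hR₂) hz.symm hm
      rw [← Complex.norm_conj] at h3
      simp only [map_sub, map_mul, map_pow, Complex.conj_conj, Complex.conj_ofReal] at h3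
      simp only [map_mul]
      refine (norm_coeff_mul_le hB d.pos (d.of_mem hy).mem h3).trans (le_of_eq (by ring))
  exact h.trans (le_of_eq (by ring))

end local_error

/-- The oscillating factors have modulus one and ε ≤ 1, so Grönwall's inequality applies in the
maximum norm with rate B independent of ε. -/
theorem IsPair.norm_le {z₁ z₂ : ℝ → ℂ} {B R : ℝ} (hz : IsPair a ε z₁ z₂)
    (hB : ∀ x ∈ Set.Icc (0 : ℝ) 1, |b a x| ≤ B) (h0 : 0 < ε) (h1 : ε ≤ 1)
    (hR₁ : ‖z₁ 0‖ ≤ R) (hR₂ : ‖z₂ 0‖ ≤ R) :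
    ∀ x ∈ Set.Icc (0 : ℝ) 1, ‖z₁ x‖ ≤ R * Real.exp B ∧ ‖z₂ x‖ ≤ R * Real.exp B := by
  intro x hx
  have hB0 : 0 ≤ B := (abs_nonneg _).trans (hB x hx)
  have hR : 0 ≤ R := (norm_nonneg _).trans hR₁
  have hd : ∀ y ∈ Set.Icc (0 : ℝ) 1, HasDerivWithinAt (fun y => (z₁ y, z₂ y))
      (ε * b a y * starRingEnd ℂ (osc a ε y) * z₂ y, ε * b a y * osc a ε y * z₁ y)
      (Set.Icc 0 1) y := fun y hy => (hz.deriv₁ y hy).prodMk (hz.deriv₂ y hy)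
  have hle : ∀ y ∈ Set.Icc (0 : ℝ) 1, ∀ z : ℂ, ‖(ε : ℂ) * b a y * osc a ε y * z‖ ≤ B * ‖z‖ := by
    intro y hy z
    refine (norm_coeff_mul_le hB h0 hy le_rfl).trans ?_
    exact mul_le_mul_of_nonneg_right (mul_le_of_le_one_left hB0 h1) (norm_nonneg _)
  have hle' : ∀ y ∈ Set.Icc (0 : ℝ) 1, ∀ z : ℂ,
      ‖(ε : ℂ) * b a y * starRingEnd ℂ (osc a ε y) * z‖ ≤ B * ‖z‖ := by
    intro y hy z
    simpa only [norm_mul, Complex.norm_conj] using hle y hy z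
  have h := norm_le_gronwallBound_of_norm_deriv_right_le (δ := R) (K := B) (ε := 0)
    (f := fun y => (z₁ y, z₂ y)) (a := 0) (b := 1)
    (fun y hy => (hd y hy).continuousWithinAt)
    (fun y hy => (hd y ⟨hy.1, hy.2.le⟩).mono_of_mem_nhdsWithin (Icc_mem_nhdsGE_of_mem hy))
    (by simpa [Prod.norm_def] using ⟨hR₁, hR₂⟩)
    (fun y hy => by
      have hy' : y ∈ Set.Icc (0 : ℝ) 1 := ⟨hy.1, hy.2.le⟩
      rw [add_zero, Prod.norm_def]
      refine max_le ((hle' y hy' _).trans ?_) ((hle y hy' _).trans ?_)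
      · exact mul_le_mul_of_nonneg_left (norm_snd_le (z₁ y, z₂ y)) hB0
      · exact mul_le_mul_of_nonneg_left (norm_fst_le (z₁ y, z₂ y)) hB0) x hx
  rw [gronwallBound_ε0, sub_zero] at h
  have h2 : R * Real.exp (B * x) ≤ R * Real.exp B :=
    mul_le_mul_of_nonneg_left (Real.exp_le_exp.2 (mul_le_of_le_one_right hB0 hx.2)) hR
  exact ⟨(norm_fst_le (z₁ x, z₂ x)).trans (h.trans h2), (norm_snd_le (z₁ x, z₂ x)).trans (h.trans h2)⟩

end

section

open Complex (I)

variable {a : ℝ → ℝ} {ε₀ ε ξ x : ℝ}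

/-! ### The exact solution -/

theorem exactZ_fst (a : ℝ → ℝ) (ε : ℝ) (φ : ℝ → ℂ) (x : ℝ) : exactZ a ε φ x 0 =
    Complex.exp (-(I / ε * phase a ε x)) *
      (((1 / √2 : ℝ) : ℂ) * (I * exactU a ε φ x 0 + exactU a ε φ x 1)) := by
  simp [exactZ, expPhase, P, Matrix.mulVec, dotProduct, Fin.sum_univ_two]
  ring

theorem exactZ_snd (a : ℝ → ℝ) (ε : ℝ) (φ : ℝ → ℂ) (x : ℝ) : exactZ a ε φ x 1 =
    Complex.exp (I / ε * phase a ε x) *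
      (((1 / √2 : ℝ) : ℂ) * (exactU a ε φ x 0 + I * exactU a ε φ x 1)) := by
  simp [exactZ, expPhase, P, Matrix.mulVec, dotProduct, Fin.sum_univ_two]
  ring

theorem exactZ_zero (a : ℝ → ℝ) (ε : ℝ) (φ : ℝ → ℂ) :
    exactZ a ε φ 0 = P *ᵥ exactU a ε φ 0 := by
  have h : expPhase ε (-phase a ε 0) = 1 := by
    have h1 : phase a ε 0 = 0 := by simp [phase]
    rw [expPhase, h1, ← Matrix.diagonal_one]
    congr 1
    ext i
    fin_cases i <;> simp
  rw [exactZ, h, Matrix.one_mulVec]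

section solution

variable (H : Admissible a ε₀) {φ₀ φ₁ : ℂ} {φ : ℝ → ℂ} (hφ : IsSolution a ε φ₀ φ₁ φ)

include hφ in
theorem IsSolution.hasDeriv (hx : x ∈ Set.Icc (0 : ℝ) 1) :
    HasDerivWithinAt φ (D φ x) (Set.Icc 0 1) x :=
  (hφ.contDiffOn.differentiableOn (by simp) x hx).hasDerivWithinAt

include hφ in
theorem IsSolution.contDiffOn_D : ContDiffOn ℝ 1 (D φ) (Set.Icc 0 1) :=
  hφ.contDiffOn.derivWithin (uniqueDiffOn_Icc one_pos) (by norm_num)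

include hφ in
theorem IsSolution.hasDeriv_D (hx : x ∈ Set.Icc (0 : ℝ) 1) :
    HasDerivWithinAt (D φ) (D (D φ) x) (Set.Icc 0 1) x :=
  (hφ.contDiffOn_D.differentiableOn (by simp) x hx).hasDerivWithinAt

include H hφ in
-- The equation is assumed in the open interval and extends to the end points by continuity.
theorem IsSolution.ode_closed (hx : x ∈ Set.Icc (0 : ℝ) 1) :
    (ε : ℂ) ^ 2 * D (D φ) x + (a x : ℂ) * φ x = 0 := by
  have h1 : ContinuousOn (D (D φ)) (Set.Icc 0 1) :=
    hφ.contDiffOn_D.continuousOn_derivWithin (uniqueDiffOn_Icc one_pos) le_rfl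
  have h2 : ContinuousOn (fun x => (ε : ℂ) ^ 2 * D (D φ) x + (a x : ℂ) * φ x) (Set.Icc 0 1) :=
    (continuousOn_const.mul h1).add
      ((Complex.continuous_ofReal.comp_continuousOn H.contDiffOn.continuousOn).mul
        hφ.contDiffOn.continuousOn)
  have h3 : Set.EqOn (fun x => (ε : ℂ) ^ 2 * D (D φ) x + (a x : ℂ) * φ x) (fun _ => 0)
      (Set.Ioo 0 1) := fun y hy => hφ.ode y hy
  exact h3.of_subset_closure h2 continuousOn_const Set.Ioo_subset_Icc_self
    (by rw [closure_Ioo zero_ne_one]) hx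

include H in
theorem hasDeriv_rpow (p : ℝ) (hx : x ∈ Set.Icc (0 : ℝ) 1) :
    HasDerivWithinAt (fun y => ((a y ^ p : ℝ) : ℂ)) ((D (fun y => a y ^ p) x : ℝ) : ℂ)
      (Set.Icc 0 1) x :=
  ((H.contDiffOn_rpow p).differentiableOn (by simp) x hx).hasDerivWithinAt.ofReal_comp

include H in
theorem hasDeriv_D_rpow (p : ℝ) (hx : x ∈ Set.Icc (0 : ℝ) 1) :
    HasDerivWithinAt (fun y => ((D (fun y => a y ^ p) y : ℝ) : ℂ))
      ((D (D (fun y => a y ^ p)) x : ℝ) : ℂ) (Set.Icc 0 1) x :=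
  ((contDiffOn_D (H.contDiffOn_rpow p)).differentiableOn (by simp) x hx).hasDerivWithinAt.ofReal_comp

include H in
theorem rpow_quarter_mul (hx : x ∈ Set.Icc (0 : ℝ) 1) :
    ((a x ^ (1 / 4 : ℝ) : ℝ) : ℂ) * ((a x ^ (-(1 / 4) : ℝ) : ℝ) : ℂ) = 1 := by
  rw [← Complex.ofReal_mul, ← Real.rpow_add (H.pos x hx)]
  simp

include H in
theorem sqrt_eq_rpow_quarter_sq (hx : x ∈ Set.Icc (0 : ℝ) 1) :
    ((√(a x) : ℝ) : ℂ) = ((a x ^ (1 / 4 : ℝ) : ℝ) : ℂ) ^ 2 := by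
  rw [← Complex.ofReal_pow, ← Real.rpow_natCast, ← Real.rpow_mul (H.pos x hx).le,
    Real.sqrt_eq_rpow]
  norm_num

include H in
theorem eq_rpow_quarter_pow (hx : x ∈ Set.Icc (0 : ℝ) 1) :
    (a x : ℂ) = ((a x ^ (1 / 4 : ℝ) : ℝ) : ℂ) ^ 4 := by
  rw [← Complex.ofReal_pow, ← Real.rpow_natCast, ← Real.rpow_mul (H.pos x hx).le]
  norm_num

include H in
theorem b_eq_rpow (hx : x ∈ Set.Icc (0 : ℝ) 1) : (b a x : ℂ) =
    -(1 / 2) * ((a x ^ (-(1 / 4) : ℝ) : ℝ) : ℂ) * (D (D fun y => a y ^ (-(1 / 4) : ℝ)) x : ℝ) := by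
  have h := rpow_quarter_mul H hx
  have hne : ((a x ^ (1 / 4 : ℝ) : ℝ) : ℂ) ≠ 0 := left_ne_zero_of_mul_eq_one h
  rw [b]
  push_cast
  rw [eq_one_div_of_mul_eq_one_right h]
  field_simp

include H in
theorem rpow_quarter_deriv (hx : x ∈ Set.Icc (0 : ℝ) 1) :
    ((D (fun y => a y ^ (1 / 4 : ℝ)) x : ℝ) : ℂ) * ((a x ^ (-(1 / 4) : ℝ) : ℝ) : ℂ) +
      ((a x ^ (1 / 4 : ℝ) : ℝ) : ℂ) * ((D (fun y => a y ^ (-(1 / 4) : ℝ)) x : ℝ) : ℂ) = 0 := by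
  have h1 := (hasDeriv_rpow H (1 / 4) hx).mul (hasDeriv_rpow H (-(1 / 4)) hx)
  have h2 : HasDerivWithinAt (fun _ : ℝ => (1 : ℂ)) 0 (Set.Icc 0 1) x := hasDerivWithinAt_const _ _ _
  exact (uniqueDiff hx).eq_deriv _ h1
    (h2.congr (fun y hy => rpow_quarter_mul H hy) (rpow_quarter_mul H hx))

include H hφ in
theorem hasDeriv_exactU_fst_aux (hx : x ∈ Set.Icc (0 : ℝ) 1) :
    HasDerivWithinAt (fun y => ((a y ^ (1 / 4 : ℝ) : ℝ) : ℂ) * φ y)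
      (((D (fun y => a y ^ (1 / 4 : ℝ)) x : ℝ) : ℂ) * φ x + ((a x ^ (1 / 4 : ℝ) : ℝ) : ℂ) * D φ x)
      (Set.Icc 0 1) x :=
  (hasDeriv_rpow H (1 / 4) hx).mul (hφ.hasDeriv hx)

include H hφ in
-- The relation a^{1/4}·a^{-1/4} = 1 trades the derivative of a^{1/4} for that of a^{-1/4}.
-- Differentiating once more then yields (a^{-1/4})'', the quantity that defines b.
theorem exactU_snd (hx : x ∈ Set.Icc (0 : ℝ) 1) : exactU a ε φ x 1 =
    ε * (((a x ^ (-(1 / 4) : ℝ) : ℝ) : ℂ) * D φ x - ((a x ^ (-(1 / 4) : ℝ) : ℝ) : ℂ) *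
      ((D (fun y => a y ^ (-(1 / 4) : ℝ)) x : ℝ) : ℂ) * (((a x ^ (1 / 4 : ℝ) : ℝ) : ℂ) * φ x)) := by
  have h1 := rpow_quarter_mul H hx
  have h2 := rpow_quarter_deriv H hx
  have hne : ((a x ^ (1 / 4 : ℝ) : ℝ) : ℂ) ≠ 0 := left_ne_zero_of_mul_eq_one h1
  simp only [exactU, Matrix.cons_val_one, Matrix.cons_val_fin_one]
  rw [D_eq hx (hasDeriv_exactU_fst_aux H hφ hx), sqrt_eq_rpow_quarter_sq H hx,
    div_eq_iff (pow_ne_zero 2 hne)]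
  grind

include H hφ in
theorem hasDeriv_exactU_fst (h0 : ε ≠ 0) (hx : x ∈ Set.Icc (0 : ℝ) 1) :
    HasDerivWithinAt (fun y => exactU a ε φ y 0) ((√(a x) : ℝ) / ε * exactU a ε φ x 1)
      (Set.Icc 0 1) x := by
  have hne : (ε : ℂ) ≠ 0 := by exact_mod_cast h0
  have hs : ((√(a x) : ℝ) : ℂ) ≠ 0 := by exact_mod_cast (Real.sqrt_pos.2 (H.pos x hx)).ne'
  have h := hasDeriv_exactU_fst_aux H hφ hx
  refine h.congr_deriv ?_
  simp only [exactU, Matrix.cons_val_one, Matrix.cons_val_fin_one]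
  rw [D_eq hx h]
  field_simp

include H hφ in
theorem hasDeriv_exactU_snd (h0 : ε ≠ 0) (hx : x ∈ Set.Icc (0 : ℝ) 1) :
    HasDerivWithinAt (fun y => exactU a ε φ y 1)
      ((2 * ε * b a x - (√(a x) : ℝ) / ε) * exactU a ε φ x 0) (Set.Icc 0 1) x := by
  have hne : (ε : ℂ) ≠ 0 := by exact_mod_cast h0
  have h1 := rpow_quarter_mul H hx
  have h2 := rpow_quarter_deriv H hx
  have hu := hasDeriv_exactU_fst_aux H hφ hx
  have hr := hasDeriv_rpow H (-(1 / 4)) hx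
  have hr' := hasDeriv_D_rpow H (-(1 / 4)) hx
  have h := (((hr.mul (hφ.hasDeriv_D hx)).sub ((hr.mul hr').mul hu)).const_mul (ε : ℂ)).congr
    (fun y hy => exactU_snd H hφ hy) (exactU_snd H hφ hx)
  refine h.congr_deriv ?_
  have hode := hφ.ode_closed H hx
  rw [eq_rpow_quarter_pow H hx] at hode
  have hφ2 : D (D φ) x = -(((a x ^ (1 / 4 : ℝ) : ℝ) : ℂ) ^ 4 * φ x) / (ε : ℂ) ^ 2 := by
    rw [eq_div_iff (pow_ne_zero 2 hne)]
    linear_combination hode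
  simp only [exactU, Matrix.cons_val_zero, Pi.mul_apply]
  rw [b_eq_rpow H hx, sqrt_eq_rpow_quarter_sq H hx, hφ2]
  grind

include H hφ in
-- For V = PU one finds V₁' = (i/ε)(√a − ε²b)V₁ + εbV₂, and symmetrically for V₂. The exponential in
-- Z removes exactly this diagonal part.
theorem isPair_exactZ (h0 : 0 < ε) (h1 : ε ≤ ε₀) :
    IsPair a ε (fun x => exactZ a ε φ x 0) (fun x => exactZ a ε φ x 1) := by
  have hne : (ε : ℂ) ≠ 0 := by exact_mod_cast h0.ne'
  have hI := Complex.I_sq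
  have key : ∀ x ∈ Set.Icc (0 : ℝ) 1,
      HasDerivWithinAt (fun y => I / ε * (phase a ε y : ℂ)) (I / ε * (phaseDeriv a ε x : ℝ))
        (Set.Icc 0 1) x := fun x hx =>
    (hasDeriv_phase (ξ := x) (x := x) H
      ⟨h0, h1, h1.trans H.le_one, hx.1, le_rfl, hx.2⟩).ofReal_comp.const_mul _
  have hosc : ∀ x, osc a ε x = Complex.exp (I / ε * phase a ε x) ^ 2 := fun x => by
    rw [osc, ← Complex.exp_nat_mul]
    congr 1
    push_cast
    ring
  have hosc' : ∀ x, starRingEnd ℂ (osc a ε x) = Complex.exp (-(I / ε * phase a ε x)) ^ 2 :=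
    fun x => by
      rw [hosc, map_pow, ← Complex.exp_conj]
      congr 2
      simp
      ring
  refine ⟨fun x hx => ?_, fun x hx => ?_⟩
  · have h := ((key x hx).neg.cexp.mul
      ((((hasDeriv_exactU_fst H hφ h0.ne' hx).const_mul I).add
        (hasDeriv_exactU_snd H hφ h0.ne' hx)).const_mul ((1 / √2 : ℝ) : ℂ)))
    refine (h.congr (fun y _ => exactZ_fst a ε φ y) (exactZ_fst a ε φ x)).congr_deriv ?_
    have he : Complex.exp (-(I / ε * phase a ε x)) * Complex.exp (I / ε * phase a ε x) = 1 := by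
      rw [← Complex.exp_add]
      simp
    rw [exactZ_snd, hosc', phaseDeriv]
    simp only [Pi.add_apply, Pi.neg_apply]
    push_cast
    generalize Complex.exp (-(I / ε * phase a ε x)) = X at *
    generalize Complex.exp (I / ε * phase a ε x) = Y at *
    field_simp
    grind
  · have h := ((key x hx).cexp.mul
      (((hasDeriv_exactU_fst H hφ h0.ne' hx).add
        ((hasDeriv_exactU_snd H hφ h0.ne' hx).const_mul I)).const_mul ((1 / √2 : ℝ) : ℂ)))
    refine (h.congr (fun y _ => exactZ_snd a ε φ y) (exactZ_snd a ε φ x)).congr_deriv ?_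
    have he : Complex.exp (-(I / ε * phase a ε x)) * Complex.exp (I / ε * phase a ε x) = 1 := by
      rw [← Complex.exp_add]
      simp
    rw [exactZ_fst, hosc, phaseDeriv]
    simp only [Pi.add_apply]
    push_cast
    generalize Complex.exp (-(I / ε * phase a ε x)) = X at *
    generalize Complex.exp (I / ε * phase a ε x) = Y at *
    field_simp
    grind

end solution

/-- The exact solution `Z` is bounded uniformly in `ε`. -/
theorem exists_bound_exactZ (H : Admissible a ε₀) (φ₀ φ₁ : ℂ) : ∃ R : ℝ, 0 ≤ R ∧
    ∀ ε, 0 < ε → ε ≤ ε₀ → ∀ φ : ℝ → ℂ, IsSolution a ε φ₀ φ₁ φ →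
      ∀ x ∈ Set.Icc (0 : ℝ) 1, ‖exactZ a ε φ x 0‖ ≤ R ∧ ‖exactZ a ε φ x 1‖ ≤ R := by
  obtain ⟨B, hB⟩ := H.smooth_b 0
  have h00 : (0 : ℝ) ∈ Set.Icc (0 : ℝ) 1 := ⟨le_rfl, zero_le_one⟩
  set A : ℂ := ((a 0 ^ (1 / 4 : ℝ) : ℝ) : ℂ)
  set r : ℂ := ((a 0 ^ (-(1 / 4) : ℝ) : ℝ) : ℂ)
  set r' : ℂ := ((D (fun y => a y ^ (-(1 / 4) : ℝ)) 0 : ℝ) : ℂ)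
  set u : ℝ := ‖A * φ₀‖
  -- The second component of U(0) equals rφ₁ − ε r r'(Aφ₀). The scaling εφ'(0) = φ₁ is what makes it
  -- bounded as ε → 0.
  set u' : ℝ := ‖r * φ₁‖ + ‖r * r' * (A * φ₀)‖
  set R : ℝ := u + u'
  have hR : 0 ≤ R := by positivity
  refine ⟨R * Real.exp B, by positivity, fun ε h0 h1 φ hφ x hx => ?_⟩
  have hU0 : ‖exactU a ε φ 0 0‖ ≤ u := by
    simp [exactU, hφ.initial_value, u, A]
  have hU1 : ‖exactU a ε φ 0 1‖ ≤ u' := by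
    have h : exactU a ε φ 0 1 = r * φ₁ - ε * (r * r' * (A * φ₀)) := by
      rw [exactU_snd H hφ h00, ← hφ.initial_deriv, ← hφ.initial_value]
      ring
    rw [h]
    refine (norm_sub_le _ _).trans (add_le_add le_rfl ?_)
    rw [norm_mul, Complex.norm_real, Real.norm_of_nonneg h0.le]
    exact mul_le_of_le_one_left (norm_nonneg _) (h1.trans H.le_one)
  have hs : ‖((1 / √2 : ℝ) : ℂ)‖ ≤ 1 := by
    rw [Complex.norm_real, Real.norm_of_nonneg (by positivity)]
    exact div_le_one_of_le₀ (Real.one_le_sqrt.2 one_le_two) (Real.sqrt_nonneg 2)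
  have h2 : phase a ε 0 = 0 := by simp [phase]
  refine (isPair_exactZ H hφ h0 h1).norm_le (fun x hx => hB ε h0 h1 x hx) h0 (h1.trans H.le_one)
    ?_ ?_ x hx
  · rw [exactZ_fst, h2]
    simp only [Complex.ofReal_zero, mul_zero, neg_zero, Complex.exp_zero, one_mul]
    rw [norm_mul]
    refine (mul_le_of_le_one_left (norm_nonneg _) hs).trans ((norm_add_le _ _).trans ?_)
    rw [norm_mul, Complex.norm_I, one_mul]
    exact add_le_add hU0 hU1
  · rw [exactZ_snd, h2]
    simp only [Complex.ofReal_zero, mul_zero, Complex.exp_zero, one_mul]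
    rw [norm_mul]
    refine (mul_le_of_le_one_left (norm_nonneg _) hs).trans ((norm_add_le _ _).trans ?_)
    rw [norm_mul, Complex.norm_I, one_mul]
    exact add_le_add hU0 hU1

end

section

open Complex (I)

variable {a : ℝ → ℝ} {ε₀ ε ξ x : ℝ}

/-! ### Convergence of one-step schemes -/

/-- The one-step matrix with off-diagonal part given by `p` and diagonal part given by `q`. -/
def stepMatrix (p q : ℂ) : Matrix (Fin 2) (Fin 2) ℂ := 1 + offDiag p + onDiag q

theorem stepMatrix_mulVec_fst (p q : ℂ) (u : Fin 2 → ℂ) :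
    (stepMatrix p q *ᵥ u) 0 = u 0 + starRingEnd ℂ p * u 1 + q * u 0 := by
  simp [stepMatrix, offDiag, onDiag, Matrix.mulVec, dotProduct, Fin.sum_univ_two]
  ring

theorem stepMatrix_mulVec_snd (p q : ℂ) (u : Fin 2 → ℂ) :
    (stepMatrix p q *ᵥ u) 1 = u 1 + p * u 0 + starRingEnd ℂ q * u 1 := by
  simp [stepMatrix, offDiag, onDiag, Matrix.mulVec, dotProduct, Fin.sum_univ_two]
  ring

theorem norm_fin_two_le {u : Fin 2 → ℂ} {C : ℝ} (h0 : ‖u 0‖ ≤ C) (h1 : ‖u 1‖ ≤ C) : ‖u‖ ≤ C :=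
  (pi_norm_le_iff_of_nonneg ((norm_nonneg _).trans h0)).2 (Fin.forall_fin_two.2 ⟨h0, h1⟩)

theorem norm_stepMatrix_mulVec_le (p q : ℂ) (u : Fin 2 → ℂ) :
    ‖stepMatrix p q *ᵥ u‖ ≤ (1 + (‖p‖ + ‖q‖)) * ‖u‖ := by
  have h0 := norm_le_pi_norm u 0
  have h1 := norm_le_pi_norm u 1
  refine norm_fin_two_le ?_ ?_
  · rw [stepMatrix_mulVec_fst]
    refine (norm_add₃_le).trans ?_
    rw [norm_mul, norm_mul, Complex.norm_conj]
    have := mul_le_mul_of_nonneg_left h1 (norm_nonneg p)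
    have := mul_le_mul_of_nonneg_left h0 (norm_nonneg q)
    linarith
  · rw [stepMatrix_mulVec_snd]
    refine (norm_add₃_le).trans ?_
    rw [norm_mul, norm_mul, Complex.norm_conj]
    have := mul_le_mul_of_nonneg_left h0 (norm_nonneg p)
    have := mul_le_mul_of_nonneg_left h1 (norm_nonneg q)
    linarith

/-- Stability and consistency imply convergence. -/
theorem norm_iterZ_sub_le {step : ℝ → ℝ → Matrix (Fin 2) (Fin 2) ℂ} {N : ℕ} (hN : 1 ≤ N)
    {Z : ℝ → Fin 2 → ℂ} {C L : ℝ} (hC : 0 ≤ C) (hL : 0 ≤ L)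
    (hstep : ∀ n < N, ∀ u, ‖step (grid N (n + 1)) (grid N n) *ᵥ u‖ ≤ (1 + C / N) * ‖u‖)
    (hloc : ∀ n < N,
      ‖Z (grid N (n + 1)) - step (grid N (n + 1)) (grid N n) *ᵥ Z (grid N n)‖ ≤ L) :
    ∀ n ≤ N, ‖iterZ step N (Z 0) n - Z (grid N n)‖ ≤ Real.exp C * (N * L) := by
  have hq : 0 ≤ C / N := by positivity
  -- Each of the n local errors is amplified by at most (1 + C/N)^n, which is at most e^C.
  have key : ∀ n ≤ N, ‖iterZ step N (Z 0) n - Z (grid N n)‖ ≤ (1 + C / N) ^ n * (n * L) := by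
    intro n
    induction n with
    | zero => intro _; simp [iterZ, grid]
    | succ n ih =>
      intro hn
      have h1 := ih (Nat.le_of_succ_le hn)
      have h2 := hloc n hn
      have h3 := hstep n hn (iterZ step N (Z 0) n - Z (grid N n))
      have heq : iterZ step N (Z 0) (n + 1) - Z (grid N (n + 1)) =
          step (grid N (n + 1)) (grid N n) *ᵥ (iterZ step N (Z 0) n - Z (grid N n)) -
          (Z (grid N (n + 1)) - step (grid N (n + 1)) (grid N n) *ᵥ Z (grid N n)) := by
        rw [Matrix.mulVec_sub, iterZ]
        abel
      rw [heq]
      refine (norm_sub_le _ _).trans ((add_le_add h3 h2).trans ?_)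
      have h4 : (1 + C / N) * ‖iterZ step N (Z 0) n - Z (grid N n)‖ ≤
          (1 + C / N) * ((1 + C / N) ^ n * (n * L)) := by gcongr
      have h5 : L ≤ (1 + C / N) ^ (n + 1) * L :=
        le_mul_of_one_le_left hL (one_le_pow₀ (by linarith))
      refine (add_le_add h4 h5).trans (le_of_eq ?_)
      push_cast
      ring
  intro n hn
  refine (key n hn).trans ?_
  have hN' : (0 : ℝ) < N := by exact_mod_cast hN
  have h1 : (1 + C / N) ^ n ≤ Real.exp C := by
    calc (1 + C / N) ^ n ≤ Real.exp (C / N) ^ n := by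
          gcongr
          linarith [Real.add_one_le_exp (C / N)]
      _ = Real.exp (n * (C / N)) := by rw [← Real.exp_nat_mul]
      _ ≤ Real.exp C := by
          refine Real.exp_le_exp.2 ?_
          rw [← mul_div_assoc, div_le_iff₀ hN', mul_comm]
          have : (n : ℝ) ≤ N := by exact_mod_cast hn
          gcongr
  have h2 : (n : ℝ) ≤ N := by exact_mod_cast hn
  gcongr

theorem grid_dom {N n : ℕ} (h0 : 0 < ε) (h1 : ε ≤ ε₀) (h2 : ε ≤ 1) (hn : n < N) :
    Dom ε₀ ε (grid N n) (grid N (n + 1)) ∧ grid N (n + 1) - grid N n = 1 / N := by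
  have hN : (0 : ℝ) < N := by exact_mod_cast (Nat.zero_le n).trans_lt hn
  have h3 : (n : ℝ) + 1 ≤ N := by exact_mod_cast hn
  refine ⟨⟨h0, h1, h2, by unfold grid; positivity, ?_, ?_⟩, ?_⟩
  · unfold grid
    push_cast
    gcongr
    linarith
  · unfold grid
    push_cast
    rwa [div_le_one hN]
  · unfold grid
    push_cast
    ring

/-- The local errors of the scheme with step matrices `stepMatrix p q` are `O(Λ ε h)`. -/
def Consistent (a : ℝ → ℝ) (ε₀ : ℝ) (p q : ℝ → ℝ → ℝ → ℂ) (Λ : ℝ → ℝ → ℝ) : Prop :=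
  ∃ K : ℝ, 0 ≤ K ∧ ∀ ε ξ x, Dom ε₀ ε ξ x → ∀ (z₁ z₂ : ℝ → ℂ) (R : ℝ), IsPair a ε z₁ z₂ →
    (∀ y ∈ Set.Icc (0 : ℝ) 1, ‖z₁ y‖ ≤ R) → (∀ y ∈ Set.Icc (0 : ℝ) 1, ‖z₂ y‖ ≤ R) →
    ‖z₂ x - z₂ ξ - p ε ξ x * z₁ ξ - starRingEnd ℂ (q ε ξ x) * z₂ ξ‖ ≤ K * R * Λ ε (x - ξ)

/-- Stability comes from p and q being O(h), consistency from the uniform bound on the exact Z; N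
steps turn Λ(ε, h) into NΛ(ε, h). -/
theorem Consistent.converges (H : Admissible a ε₀) {p q : ℝ → ℝ → ℝ → ℂ} {Λ : ℝ → ℝ → ℝ}
    (hp : OO ε₀ 0 1 p) (hq : OO ε₀ 0 1 q) (h : Consistent a ε₀ p q Λ) (φ₀ φ₁ : ℂ) :
    ∃ K : ℝ, ∀ ε, 0 < ε → ε ≤ ε₀ → ∀ φ : ℝ → ℂ, IsSolution a ε φ₀ φ₁ φ →
      ∀ N : ℕ, 1 ≤ N → ∀ n ≤ N,
        ‖iterZ (fun η ξ => stepMatrix (p ε ξ η) (q ε ξ η)) N (P *ᵥ exactU a ε φ 0) n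
          - exactZ a ε φ (grid N n)‖ ≤ K * (N * Λ ε (1 / N)) := by
  obtain ⟨Cp, hCp, hp⟩ := hp
  obtain ⟨Cq, hCq, hq⟩ := hq
  obtain ⟨K, hK, h⟩ := h
  obtain ⟨R, hR, hZ⟩ := exists_bound_exactZ H φ₀ φ₁
  refine ⟨Real.exp (Cp + Cq) * (K * R), fun ε h0 h1 φ hφ N hN n hn => ?_⟩
  have hb := hZ ε h0 h1 φ hφ
  have hpair := isPair_exactZ H hφ h0 h1
  have hloc : ∀ n < N, ‖exactZ a ε φ (grid N (n + 1)) -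
      stepMatrix (p ε (grid N n) (grid N (n + 1))) (q ε (grid N n) (grid N (n + 1))) *ᵥ
        exactZ a ε φ (grid N n)‖ ≤ K * R * Λ ε (1 / N) := by
    intro n hn
    obtain ⟨d, hd⟩ := grid_dom h0 h1 (h1.trans H.le_one) hn
    rw [← hd]
    refine norm_fin_two_le ?_ ?_
    -- The first component is, after conjugation, the second component of the swapped pair.
    · have h2 := h ε _ _ d _ _ R hpair.symm (by simpa using fun y hy hy' => (hb y ⟨hy, hy'⟩).2)
        (by simpa using fun y hy hy' => (hb y ⟨hy, hy'⟩).1)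
      rw [← Complex.norm_conj] at h2
      simp only [map_sub, map_mul, Complex.conj_conj] at h2
      rw [Pi.sub_apply, stepMatrix_mulVec_fst]
      convert h2 using 2
      ring
    · have h2 := h ε _ _ d _ _ R hpair (fun y hy => (hb y hy).1) (fun y hy => (hb y hy).2)
      rw [Pi.sub_apply, stepMatrix_mulVec_snd]
      convert h2 using 2
      ring
  have hstep : ∀ n < N, ∀ u, ‖stepMatrix (p ε (grid N n) (grid N (n + 1)))
      (q ε (grid N n) (grid N (n + 1))) *ᵥ u‖ ≤ (1 + (Cp + Cq) / N) * ‖u‖ := by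
    intro n hn u
    obtain ⟨d, hd⟩ := grid_dom h0 h1 (h1.trans H.le_one) hn
    refine (norm_stepMatrix_mulVec_le _ _ _).trans (mul_le_mul_of_nonneg_right ?_ (norm_nonneg _))
    have h2 := hp ε _ _ d
    have h3 := hq ε _ _ d
    rw [hd] at h2 h3
    simp only [pow_zero, pow_one, one_mul] at h2 h3
    rw [add_div, div_eq_mul_one_div Cp, div_eq_mul_one_div Cq]
    linarith
  have hL : 0 ≤ K * R * Λ ε (1 / N) := (norm_nonneg _).trans (hloc 0 hN)
  have h4 := norm_iterZ_sub_le (step := fun η ξ => stepMatrix (p ε ξ η) (q ε ξ η)) hN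
    (add_nonneg hCp hCq) hL hstep hloc n hn
  rw [exactZ_zero] at h4
  refine h4.trans (le_of_eq ?_)
  ring

/-! ### Consistency of WKB2 and WKB3 -/

section consistency

variable {j k : ℕ} {f g : ℝ → ℝ → ℝ → ℂ}

theorem OO.of_sub (hf : OO ε₀ j k f) (h : OO ε₀ j k (fun ε ξ x => f ε ξ x - g ε ξ x)) :
    OO ε₀ j k g :=
  (hf.add (h.smul (-1))).congr fun ε ξ x _ => by ring

variable (H : Admissible a ε₀) {m₁ m₂ m₃ : ℝ → ℝ → ℝ → ℂ} (hm : Picard a ε₀ m₁ m₂ m₃)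
include H hm

theorem OO_picard_one : OO ε₀ 0 1 m₁ :=
  (H.smooth_b.OO_right.mul (OO_w H 0)).integrate hm.zero₁ hm.deriv₁

theorem OO_picard_two : OO ε₀ 0 1 m₂ :=
  (((H.smooth_b.OO_right.mul (OO_v H 0)).mul (OO_picard_one H hm)).mono le_rfl
    (Nat.zero_le _)).integrate hm.zero₂ hm.deriv₂

theorem OO_picard_three : OO ε₀ 0 1 m₃ :=
  (((H.smooth_b.OO_right.mul (OO_w H 0)).mul (OO_picard_two H hm)).mono le_rfl
    (Nat.zero_le _)).integrate hm.zero₃ hm.deriv₃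

end consistency

variable (H : Admissible a ε₀)
include H

/-- Provides stability: the Picard iterate is O(x − ξ) and differs from Q by something smaller
still. -/
theorem OO_offDiag_two : OO ε₀ 0 1 (fun ε ξ x => ε * Q1 a ε 2 x ξ) := by
  obtain ⟨m₁, m₂, m₃, hm⟩ := exists_picard H
  exact ((OO.eps_mul 1 ((OO_osc.bdd_mul (OO_picard_one H hm)).of_sub
    ((OO_Q1_two H hm).mono (Nat.zero_le _) (by norm_num)))).mono (Nat.zero_le _) le_rfl).congr
      fun ε ξ x _ => by rw [pow_one]

theorem OO_onDiag_two : OO ε₀ 0 1 (fun ε ξ x => ε ^ 2 * Q22 a ε x ξ) := by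
  obtain ⟨m₁, m₂, m₃, hm⟩ := exists_picard H
  exact (OO.eps_mul 2 ((OO_picard_two H hm).of_sub
    ((OO_Q22 H hm).mono (Nat.zero_le _) (by norm_num)))).mono (Nat.zero_le _) le_rfl

theorem OO_offDiag_three : OO ε₀ 0 1 (fun ε ξ x => ε * Q1 a ε 3 x ξ + ε ^ 3 * Q33 a ε x ξ) := by
  obtain ⟨m₁, m₂, m₃, hm⟩ := exists_picard H
  have h1 := (OO.eps_mul 1 ((OO_osc.bdd_mul (OO_picard_one H hm)).of_sub
    ((OO_Q1_three H hm).mono (Nat.zero_le _) (by norm_num)))).mono (Nat.zero_le 1) le_rfl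
  have h2 := (OO.eps_mul 3 ((OO_osc.bdd_mul (OO_picard_three H hm)).of_sub
    ((OO_Q33 H hm).mono (Nat.zero_le _) (by norm_num)))).mono (Nat.zero_le 3) le_rfl
  exact ((h1.mono (Nat.zero_le _) le_rfl).add (h2.mono (Nat.zero_le _) le_rfl)).congr
    fun ε ξ x _ => by rw [pow_one]

theorem OO_onDiag_three : OO ε₀ 0 1 (fun ε ξ x => ε ^ 2 * Q23 a ε x ξ) := by
  obtain ⟨m₁, m₂, m₃, hm⟩ := exists_picard H
  obtain ⟨r, hr, h⟩ := OO_Q23 H hm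
  have h1 : OO ε₀ 0 1 (fun ε ξ x => m₂ ε ξ x - Q23 a ε x ξ) :=
    ((hr.mono (Nat.zero_le _) (by norm_num)).add (h.mono (Nat.zero_le _) (by norm_num))).congr
      fun ε ξ x _ => by ring
  exact (OO.eps_mul 2 ((OO_picard_two H hm).of_sub h1)).mono (Nat.zero_le _) le_rfl

/-- The Picard truncation gives ε³h³, the error of Q₁ gives ε·ε²h³ and that of Q₂ gives ε²·εh³. -/
theorem consistent_two : Consistent a ε₀ (fun ε ξ x => ε * Q1 a ε 2 x ξ)
    (fun ε ξ x => ε ^ 2 * Q22 a ε x ξ) (fun ε h => ε ^ 3 * h ^ 3) := by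
  obtain ⟨m₁, m₂, m₃, hm⟩ := exists_picard H
  obtain ⟨B, hB⟩ := H.smooth_b 0
  obtain ⟨C₁, hC₁, h₁⟩ := OO.eps_mul 1 (OO_Q1_two H hm)
  obtain ⟨C₂, hC₂, h₂⟩ := OO.eps_mul 2 (OO_Q22 H hm)
  refine ⟨|B| ^ 3 + C₁ + C₂, by positivity, fun ε ξ x d z₁ z₂ R hz hR₁ hR₂ => ?_⟩
  have h3 := hz.taylor_two (fun x hx => (hB ε d.pos d.le x hx).trans (le_abs_self B)) d hR₁ hm
  have h4 := h₁ ε ξ x d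
  have h5 := h₂ ε ξ x d
  have hR : 0 ≤ R := (norm_nonneg _).trans (hR₁ ξ d.mem_left)
  have h6 := mul_le_mul h4 (hR₁ ξ d.mem_left) (norm_nonneg _) ((norm_nonneg _).trans h4)
  have h7 := mul_le_mul h5 (hR₂ ξ d.mem_left) (norm_nonneg _) ((norm_nonneg _).trans h5)
  rw [← norm_mul] at h6
  rw [← Complex.norm_conj, ← norm_mul] at h7
  simp only [map_sub, map_mul, map_pow, Complex.conj_ofReal] at h7 ⊢
  have heq : z₂ x - z₂ ξ - ε * Q1 a ε 2 x ξ * z₁ ξ -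
      ε ^ 2 * starRingEnd ℂ (Q22 a ε x ξ) * z₂ ξ =
      (z₂ x - z₂ ξ - ε * (osc a ε ξ * m₁ ε ξ x) * z₁ ξ
        - ε ^ 2 * starRingEnd ℂ (m₂ ε ξ x) * z₂ ξ)
      + (ε : ℂ) ^ 1 * (osc a ε ξ * m₁ ε ξ x - Q1 a ε 2 x ξ) * z₁ ξ
      + (ε : ℂ) ^ 2 * (starRingEnd ℂ (m₂ ε ξ x) - starRingEnd ℂ (Q22 a ε x ξ)) * z₂ ξ := by ring
  rw [heq]
  refine norm_add₃_le.trans ((add_le_add (add_le_add h3 h6) h7).trans (le_of_eq ?_))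
  ring

/-- Truncation and the errors of Q₁, Q₂, Q₃ without Simpson's rule are all O(ε⁴h⁴); Simpson's rule
adds ε²·εh⁵. Both are at most ε³h⁴ max(ε, h) up to constants. -/
theorem consistent_three :
    Consistent a ε₀ (fun ε ξ x => ε * Q1 a ε 3 x ξ + ε ^ 3 * Q33 a ε x ξ)
      (fun ε ξ x => ε ^ 2 * Q23 a ε x ξ) (fun ε h => ε ^ 3 * h ^ 4 * max ε h) := by
  obtain ⟨m₁, m₂, m₃, hm⟩ := exists_picard H
  obtain ⟨B, hB⟩ := H.smooth_b 0
  obtain ⟨C₁, hC₁, h₁⟩ := ((OO.eps_mul 1 (OO_Q1_three H hm)).add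
    (OO.eps_mul 3 (OO_Q33 H hm)))
  obtain ⟨r, hr, hr2⟩ := OO_Q23 H hm
  obtain ⟨C₂, hC₂, h₂⟩ := OO.eps_mul 2 hr
  obtain ⟨C₃, hC₃, h₃⟩ := OO.eps_mul 2 hr2
  refine ⟨|B| ^ 4 + C₁ + C₂ + C₃, by positivity, fun ε ξ x d z₁ z₂ R hz hR₁ hR₂ => ?_⟩
  have h3 := hz.taylor_three (fun x hx => (hB ε d.pos d.le x hx).trans (le_abs_self B)) d hR₂ hm
  have h4 := h₁ ε ξ x d
  have h5 := h₂ ε ξ x d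
  have h5' := h₃ ε ξ x d
  have hR : 0 ≤ R := (norm_nonneg _).trans (hR₁ ξ d.mem_left)
  have h6 := mul_le_mul h4 (hR₁ ξ d.mem_left) (norm_nonneg _) ((norm_nonneg _).trans h4)
  have h7 := mul_le_mul h5 (hR₂ ξ d.mem_left) (norm_nonneg _) ((norm_nonneg _).trans h5)
  have h8 := mul_le_mul h5' (hR₂ ξ d.mem_left) (norm_nonneg _) ((norm_nonneg _).trans h5')
  rw [← norm_mul] at h6
  rw [← Complex.norm_conj, ← norm_mul] at h7 h8
  simp only [map_sub, map_mul, map_pow, Complex.conj_ofReal] at h7 h8 ⊢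
  have heq : z₂ x - z₂ ξ - (ε * Q1 a ε 3 x ξ + ε ^ 3 * Q33 a ε x ξ) * z₁ ξ -
      ε ^ 2 * starRingEnd ℂ (Q23 a ε x ξ) * z₂ ξ =
      (z₂ x - z₂ ξ - ε * (osc a ε ξ * m₁ ε ξ x) * z₁ ξ
        - ε ^ 2 * starRingEnd ℂ (m₂ ε ξ x) * z₂ ξ - ε ^ 3 * (osc a ε ξ * m₃ ε ξ x) * z₁ ξ)
      + ((ε : ℂ) ^ 1 * (osc a ε ξ * m₁ ε ξ x - Q1 a ε 3 x ξ)
        + (ε : ℂ) ^ 3 * (osc a ε ξ * m₃ ε ξ x - Q33 a ε x ξ)) * z₁ ξ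
      + ((ε : ℂ) ^ 2 * starRingEnd ℂ (r ε ξ x) * z₂ ξ
      + (ε : ℂ) ^ 2 * (starRingEnd ℂ (m₂ ε ξ x) - starRingEnd ℂ (Q23 a ε x ξ)
        - starRingEnd ℂ (r ε ξ x)) * z₂ ξ) := by ring
  rw [heq]
  refine norm_add₃_le.trans ((add_le_add (add_le_add h3 h6)
    ((norm_add_le _ _).trans (add_le_add h7 h8))).trans ?_)
  set t := x - ξ
  have ht : 0 ≤ t := sub_nonneg.2 d.ordered
  have hε := d.pos.le
  have e1 : ε ^ 4 * t ^ 4 ≤ ε ^ 3 * t ^ 4 * max ε t := by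
    calc ε ^ 4 * t ^ 4 = ε ^ 3 * t ^ 4 * ε := by ring
      _ ≤ _ := by gcongr; exact le_max_left _ _
  have e2 : ε ^ 3 * t ^ 5 ≤ ε ^ 3 * t ^ 4 * max ε t := by
    calc ε ^ 3 * t ^ 5 = ε ^ 3 * t ^ 4 * t := by ring
      _ ≤ _ := by gcongr; exact le_max_right _ _
  calc _ = (|B| ^ 4 + C₁ + C₃) * R * (ε ^ 4 * t ^ 4) + C₂ * R * (ε ^ 3 * t ^ 5) := by ring
    _ ≤ (|B| ^ 4 + C₁ + C₃) * R * (ε ^ 3 * t ^ 4 * max ε t)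
        + C₂ * R * (ε ^ 3 * t ^ 4 * max ε t) := by gcongr
    _ = _ := by ring

end

section

open Complex (I)

variable {a : ℝ → ℝ} {ε₀ ε : ℝ}

/-! ### The schemes in terms of `Z` -/

theorem step2_eq (a : ℝ → ℝ) (ε η ξ : ℝ) :
    step2 a ε η ξ = stepMatrix (ε * Q1 a ε 2 η ξ) (ε ^ 2 * Q22 a ε η ξ) := by
  ext i j
  fin_cases i <;> fin_cases j <;> simp [step2, stepMatrix, offDiag, onDiag]

theorem step3_eq (a : ℝ → ℝ) (ε η ξ : ℝ) : step3 a ε η ξ =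
    stepMatrix (ε * Q1 a ε 3 η ξ + ε ^ 3 * Q33 a ε η ξ) (ε ^ 2 * Q23 a ε η ξ) := by
  ext i j
  fin_cases i <;> fin_cases j <;> simp [step3, stepMatrix, offDiag, onDiag]

theorem exists_bound_Z2 (H : Admissible a ε₀) (φ₀ φ₁ : ℂ) :
    ∃ K : ℝ, ∀ ε, 0 < ε → ε ≤ ε₀ → ∀ φ : ℝ → ℂ, IsSolution a ε φ₀ φ₁ φ →
      ∀ N : ℕ, 1 ≤ N → ∀ n ≤ N,
        ‖Z2 a ε φ N n - exactZ a ε φ (grid N n)‖ ≤ K * (ε ^ 3 * (1 / (N : ℝ)) ^ 2) := by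
  obtain ⟨K, hK⟩ := (consistent_two H).converges H (OO_offDiag_two H) (OO_onDiag_two H) φ₀ φ₁
  refine ⟨K, fun ε h0 h1 φ hφ N hN n hn => ?_⟩
  have hN' : (N : ℝ) ≠ 0 := by positivity
  have h := hK ε h0 h1 φ hφ N hN n hn
  simp only [← step2_eq] at h
  refine h.trans (le_of_eq ?_)
  field_simp

theorem exists_bound_Z3 (H : Admissible a ε₀) (φ₀ φ₁ : ℂ) :
    ∃ K : ℝ, ∀ ε, 0 < ε → ε ≤ ε₀ → ∀ φ : ℝ → ℂ, IsSolution a ε φ₀ φ₁ φ →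
      ∀ N : ℕ, 1 ≤ N → ∀ n ≤ N, ‖Z3 a ε φ N n - exactZ a ε φ (grid N n)‖ ≤
        K * (ε ^ 3 * (1 / (N : ℝ)) ^ 3 * max ε (1 / N)) := by
  obtain ⟨K, hK⟩ := (consistent_three H).converges H (OO_offDiag_three H) (OO_onDiag_three H) φ₀ φ₁
  refine ⟨K, fun ε h0 h1 φ hφ N hN n hn => ?_⟩
  have hN' : (N : ℝ) ≠ 0 := by positivity
  have h := hK ε h0 h1 φ hφ N hN n hn
  simp only [← step3_eq] at h
  refine h.trans (le_of_eq ?_)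
  field_simp

/-! ### The backward transformation -/

theorem backU_fst (ε t : ℝ) (u : Fin 2 → ℂ) : backU ε t u 0 = ((1 / √2 : ℝ) : ℂ) *
    (-I * (Complex.exp (I / ε * t) * u 0) + Complex.exp (-(I / ε * t)) * u 1) := by
  simp [backU, expPhase, Pinv, Matrix.mulVec, dotProduct, Fin.sum_univ_two]
  ring

theorem backU_snd (ε t : ℝ) (u : Fin 2 → ℂ) : backU ε t u 1 = ((1 / √2 : ℝ) : ℂ) *
    (Complex.exp (I / ε * t) * u 0 - I * (Complex.exp (-(I / ε * t)) * u 1)) := by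
  simp [backU, expPhase, Pinv, Matrix.mulVec, dotProduct, Fin.sum_univ_two]
  ring

theorem norm_one_div_sqrt_two_mul_le (z : ℂ) : ‖((1 / √2 : ℝ) : ℂ) * z‖ ≤ ‖z‖ := by
  rw [norm_mul, Complex.norm_real, Real.norm_of_nonneg (by positivity)]
  exact mul_le_of_le_one_left (norm_nonneg _)
    (div_le_one_of_le₀ (Real.one_le_sqrt.2 one_le_two) (Real.sqrt_nonneg 2))

theorem I_div_mul_eq (ε t : ℝ) : I / ε * t = I * ((t / ε : ℝ) : ℂ) := by
  push_cast
  ring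

theorem neg_I_div_mul_eq (ε t : ℝ) : -(I / ε * t) = I * ((-t / ε : ℝ) : ℂ) := by
  push_cast
  ring

theorem norm_exp_I_mul (t : ℝ) : ‖Complex.exp (I * t)‖ = 1 := by
  rw [mul_comm, Complex.norm_exp_ofReal_mul_I]

theorem norm_exp_sub_exp_le (t t' : ℝ) :
    ‖Complex.exp (I * t) - Complex.exp (I * t')‖ ≤ |t - t'| := by
  have h : Complex.exp (I * t) - Complex.exp (I * t') =
      Complex.exp (I * t') * (Complex.exp (I * ((t - t' : ℝ) : ℂ)) - 1) := by
    rw [mul_sub, ← Complex.exp_add, mul_one]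
    congr 2
    push_cast
    ring
  rw [h, norm_mul, norm_exp_I_mul, one_mul]
  exact Real.norm_exp_I_mul_ofReal_sub_one_le

theorem norm_backU_le (ε t : ℝ) (u : Fin 2 → ℂ) : ‖backU ε t u‖ ≤ 2 * ‖u‖ := by
  have h0 := norm_le_pi_norm u 0
  have h1 := norm_le_pi_norm u 1
  have e0 : ‖Complex.exp (I / ε * t) * u 0‖ = ‖u 0‖ := by
    rw [norm_mul, I_div_mul_eq, norm_exp_I_mul, one_mul]
  have e1 : ‖Complex.exp (-(I / ε * t)) * u 1‖ = ‖u 1‖ := by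
    rw [norm_mul, neg_I_div_mul_eq, norm_exp_I_mul, one_mul]
  refine norm_fin_two_le ?_ ?_
  · rw [backU_fst]
    refine (norm_one_div_sqrt_two_mul_le _).trans ((norm_add_le _ _).trans ?_)
    rw [norm_mul, norm_neg, Complex.norm_I, one_mul, e0, e1]
    linarith
  · rw [backU_snd]
    refine (norm_one_div_sqrt_two_mul_le _).trans ((norm_sub_le _ _).trans ?_)
    rw [norm_mul I, Complex.norm_I, one_mul, e0, e1]
    linarith

theorem norm_backU_sub_le (h0 : 0 < ε) (t t' : ℝ) (u : Fin 2 → ℂ) :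
    ‖backU ε t u - backU ε t' u‖ ≤ 2 * (|t - t'| / ε * ‖u‖) := by
  have b0 := norm_le_pi_norm u 0
  have b1 := norm_le_pi_norm u 1
  have hnn : 0 ≤ |t - t'| / ε := by positivity
  have e0 : ‖(Complex.exp (I / ε * t) - Complex.exp (I / ε * t')) * u 0‖ ≤
      |t - t'| / ε * ‖u‖ := by
    rw [norm_mul, I_div_mul_eq, I_div_mul_eq]
    refine mul_le_mul ((norm_exp_sub_exp_le _ _).trans (le_of_eq ?_)) b0 (norm_nonneg _) hnn
    rw [← sub_div, abs_div, abs_of_pos h0]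
  have e1 : ‖(Complex.exp (-(I / ε * t)) - Complex.exp (-(I / ε * t'))) * u 1‖ ≤
      |t - t'| / ε * ‖u‖ := by
    rw [norm_mul, neg_I_div_mul_eq, neg_I_div_mul_eq]
    refine mul_le_mul ((norm_exp_sub_exp_le _ _).trans (le_of_eq ?_)) b1 (norm_nonneg _) hnn
    rw [← sub_div, abs_div, abs_of_pos h0, neg_sub_neg, abs_sub_comm]
  refine norm_fin_two_le ?_ ?_
  · have heq : (backU ε t u - backU ε t' u) 0 = ((1 / √2 : ℝ) : ℂ) *
        (-I * ((Complex.exp (I / ε * t) - Complex.exp (I / ε * t')) * u 0) +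
          (Complex.exp (-(I / ε * t)) - Complex.exp (-(I / ε * t'))) * u 1) := by
      rw [Pi.sub_apply, backU_fst, backU_fst]
      ring
    rw [heq]
    refine (norm_one_div_sqrt_two_mul_le _).trans ((norm_add_le _ _).trans ?_)
    rw [norm_mul (-I), norm_neg, Complex.norm_I, one_mul]
    linarith
  · have heq : (backU ε t u - backU ε t' u) 1 = ((1 / √2 : ℝ) : ℂ) *
        ((Complex.exp (I / ε * t) - Complex.exp (I / ε * t')) * u 0 -
          I * ((Complex.exp (-(I / ε * t)) - Complex.exp (-(I / ε * t'))) * u 1)) := by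
      rw [Pi.sub_apply, backU_snd, backU_snd]
      ring
    rw [heq]
    refine (norm_one_div_sqrt_two_mul_le _).trans ((norm_sub_le _ _).trans ?_)
    rw [norm_mul I, Complex.norm_I, one_mul]
    linarith

theorem backU_sub (ε t : ℝ) (u u' : Fin 2 → ℂ) :
    backU ε t (u - u') = backU ε t u - backU ε t u' := by
  simp only [backU, Matrix.mulVec_sub]

theorem backU_exactZ (a : ℝ → ℝ) (ε : ℝ) (φ : ℝ → ℂ) (x : ℝ) :
    backU ε (phase a ε x) (exactZ a ε φ x) = exactU a ε φ x := by
  have hI := Complex.I_sq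
  have he : Complex.exp (I / ε * phase a ε x) * Complex.exp (-(I / ε * phase a ε x)) = 1 := by
    rw [← Complex.exp_add]
    simp
  have hs : ((1 / √2 : ℝ) : ℂ) * ((1 / √2 : ℝ) : ℂ) * 2 = 1 := by
    rw [← Complex.ofReal_mul, div_mul_div_comm, one_mul, Real.mul_self_sqrt (by norm_num)]
    push_cast
    norm_num
  ext i
  fin_cases i
  · simp only [Fin.zero_eta]
    rw [backU_fst, exactZ_fst, exactZ_snd]
    generalize Complex.exp (I / ε * phase a ε x) = X at *
    generalize Complex.exp (-(I / ε * phase a ε x)) = Y at *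
    generalize ((1 / √2 : ℝ) : ℂ) = σ at *
    grind
  · simp only [Fin.mk_one]
    rw [backU_snd, exactZ_fst, exactZ_snd]
    generalize Complex.exp (I / ε * phase a ε x) = X at *
    generalize Complex.exp (-(I / ε * phase a ε x)) = Y at *
    generalize ((1 / √2 : ℝ) : ℂ) = σ at *
    grind

/-- Inserting the exact Z with the approximate phase separates the two errors: the phase error,
divided by ε, acts on the bounded exact Z, and the scheme error is transported by a bounded map. -/
theorem norm_backU_sub_exactU_le (h0 : 0 < ε) (t x : ℝ) (φ : ℝ → ℂ) (u : Fin 2 → ℂ) :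
    ‖backU ε t u - exactU a ε φ x‖ ≤
      2 * (|t - phase a ε x| / ε * ‖exactZ a ε φ x‖) + 2 * ‖u - exactZ a ε φ x‖ := by
  have heq : backU ε t u - exactU a ε φ x =
      (backU ε t (exactZ a ε φ x) - backU ε (phase a ε x) (exactZ a ε φ x)) +
      backU ε t (u - exactZ a ε φ x) := by
    rw [backU_sub, backU_exactZ]
    abel
  rw [heq]
  exact (norm_add_le _ _).trans
    (add_le_add (norm_backU_sub_le h0 _ _ _) (norm_backU_le _ _ _))

/-! ### The phase quadrature -/

/-- The order condition has a constant depending on the integrand, while φ' varies with ε. Linearity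
of the rule reduces to the two fixed integrands √a and b, and ε² ≤ 1. -/
theorem exists_bound_phaseApprox (H : Admissible a ε₀) {M : IntegrationMethod} {γ : ℝ}
    (hM : M.HasOrder γ) : ∃ K : ℝ, 0 ≤ K ∧ ∀ ε, 0 < ε → ε ≤ ε₀ → ∀ N : ℕ, 1 ≤ N → ∀ n ≤ N,
      |phaseApprox M a ε N n - phase a ε (grid N n)| ≤ K * (1 / (N : ℝ)) ^ γ := by
  obtain ⟨K₁, h₁⟩ := hM _ H.contDiffOn_sqrt
  obtain ⟨K₂, h₂⟩ := hM _ H.contDiffOn_b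
  refine ⟨|K₁| + |K₂|, by positivity, fun ε h0 h1 N hN n hn => ?_⟩
  have hN' : (0 : ℝ) < N := by exact_mod_cast hN
  have hg0 : 0 ≤ grid N n := by unfold grid; positivity
  have hg1 : grid N n ≤ 1 := by
    unfold grid
    rw [div_le_one hN']
    exact_mod_cast hn
  have hint : ∀ f : ℝ → ℝ, ContDiffOn ℝ ∞ f (Set.Icc 0 1) →
      IntervalIntegrable f MeasureTheory.volume 0 (grid N n) := fun f hf =>
    (hf.continuousOn.mono (by
      rw [Set.uIcc_of_le hg0]
      exact Set.Icc_subset_Icc_right hg1)).intervalIntegrable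
  have e1 : phaseDeriv a ε = (fun x => √(a x)) - ε ^ 2 • b a := by
    funext x
    simp [phaseDeriv]
  have e2 : phase a ε (grid N n) = (∫ τ in (0 : ℝ)..grid N n, √(a τ)) -
      ε ^ 2 * ∫ τ in (0 : ℝ)..grid N n, b a τ := by
    rw [phase, ← intervalIntegral.integral_const_mul,
      ← intervalIntegral.integral_sub (hint _ H.contDiffOn_sqrt)
        ((hint _ H.contDiffOn_b).const_mul _)]
    rfl
  have hε : ε ^ 2 ≤ 1 := pow_le_one₀ h0.le (h1.trans H.le_one)
  have hp : 0 ≤ (1 / (N : ℝ)) ^ γ := by positivity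
  rw [phaseApprox, e1, e2, map_sub, map_smul, smul_eq_mul]
  have h3 := (h₁ N hN n hn).trans (mul_le_mul_of_nonneg_right (le_abs_self K₁) hp)
  have h4 := (h₂ N hN n hn).trans (mul_le_mul_of_nonneg_right (le_abs_self K₂) hp)
  calc _ = |(M N n (fun x => √(a x)) - ∫ τ in (0 : ℝ)..grid N n, √(a τ))
        - ε ^ 2 * (M N n (b a) - ∫ τ in (0 : ℝ)..grid N n, b a τ)| := by
        congr 1
        ring
    _ ≤ |M N n (fun x => √(a x)) - ∫ τ in (0 : ℝ)..grid N n, √(a τ)|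
        + ε ^ 2 * |M N n (b a) - ∫ τ in (0 : ℝ)..grid N n, b a τ| := by
        refine (abs_sub _ _).trans ?_
        rw [abs_mul, abs_of_nonneg (sq_nonneg ε)]
    _ ≤ |K₁| * (1 / (N : ℝ)) ^ γ + 1 * (|K₂| * (1 / (N : ℝ)) ^ γ) := by gcongr
    _ = _ := by ring

theorem exists_seminorm_le (ν : Seminorm ℂ (Fin 2 → ℂ)) :
    ∃ C : ℝ, 0 ≤ C ∧ ∀ u : Fin 2 → ℂ, ν u ≤ C * ‖u‖ := by
  refine ⟨ν ![1, 0] + ν ![0, 1], add_nonneg (apply_nonneg _ _) (apply_nonneg _ _), fun u => ?_⟩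
  have heq : u = u 0 • ![1, 0] + u 1 • ![0, 1] := by
    ext i
    fin_cases i <;> simp
  calc ν u = ν (u 0 • ![1, 0] + u 1 • ![0, 1]) := by rw [← heq]
    _ ≤ ν (u 0 • ![1, 0]) + ν (u 1 • ![0, 1]) := map_add_le_add _ _ _
    _ = ‖u 0‖ * ν ![1, 0] + ‖u 1‖ * ν ![0, 1] := by rw [map_smul_eq_mul, map_smul_eq_mul]
    _ ≤ ‖u‖ * ν ![1, 0] + ‖u‖ * ν ![0, 1] :=
        add_le_add (mul_le_mul_of_nonneg_right (norm_le_pi_norm u 0) (apply_nonneg _ _))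
          (mul_le_mul_of_nonneg_right (norm_le_pi_norm u 1) (apply_nonneg _ _))
    _ = _ := by ring

end

end WKB

end

/-! ### Assembly of the error bounds -/

theorem theorem1 (a : ℝ → ℝ) (a₀ : ℝ) (ha₀ : 0 < a₀)
    (ha : ContDiffOn ℝ ∞ a (Set.Icc 0 1)) (hpos : ∀ x ∈ Set.Icc (0 : ℝ) 1, a₀ ≤ a x)
    (ε₀ : ℝ) (hε₀ : 0 < ε₀) (hε₀_le : ε₀ ≤ 1)
    (hphase : ∀ ε : ℝ, 0 < ε → ε ≤ ε₀ → ∀ x ∈ Set.Icc (0 : ℝ) 1, WKB.phaseDeriv a ε x ≠ 0)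
    (φ₀ φ₁ : ℂ)
    (ν : Seminorm ℂ (Fin 2 → ℂ)) (hν : ∀ v : Fin 2 → ℂ, ν v = 0 → v = 0)
    (I : WKB.IntegrationMethod) (γ : ℝ) (hγ : 0 < γ) (hI : I.HasOrder γ) :
    ∃ C : ℝ, ∀ ε : ℝ, 0 < ε → ε ≤ ε₀ →
      ∀ φ : ℝ → ℂ, WKB.IsSolution a ε φ₀ φ₁ φ →
      ∀ (N : ℕ) (h : ℝ), 1 ≤ N → h = 1 / (N : ℝ) → ∀ n : ℕ, n ≤ N →
        ν (WKB.Z2 a ε φ N n - WKB.exactZ a ε φ (WKB.grid N n)) ≤ C * ε ^ 3 * h ^ 2 ∧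
        ν (WKB.backU ε (WKB.phaseApprox I a ε N n) (WKB.Z2 a ε φ N n)
            - WKB.exactU a ε φ (WKB.grid N n)) ≤ C * h ^ γ / ε + C * ε ^ 3 * h ^ 2 ∧
        ν (WKB.Z3 a ε φ N n - WKB.exactZ a ε φ (WKB.grid N n))
          ≤ C * ε ^ 3 * h ^ 3 * max ε h ∧
        ν (WKB.backU ε (WKB.phaseApprox I a ε N n) (WKB.Z3 a ε φ N n)
            - WKB.exactU a ε φ (WKB.grid N n))
          ≤ C * h ^ γ / ε + C * ε ^ 3 * h ^ 3 * max ε h := by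
  have H : WKB.Admissible a ε₀ := ⟨ha, fun x hx => ha₀.trans_le (hpos x hx), hε₀_le, hphase⟩
  obtain ⟨C, hC, hν'⟩ := WKB.exists_seminorm_le ν
  obtain ⟨K₂, h₂⟩ := WKB.exists_bound_Z2 H φ₀ φ₁
  obtain ⟨K₃, h₃⟩ := WKB.exists_bound_Z3 H φ₀ φ₁
  obtain ⟨R, hR, hZ⟩ := WKB.exists_bound_exactZ H φ₀ φ₁
  obtain ⟨K, hK, hφ⟩ := WKB.exists_bound_phaseApprox H hI
  -- `C` compares `ν` with the maximum norm, the 2 comes from the backward transformation, and K·R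
  -- is phase error times the bound on Z. One constant serves all four estimates.
  refine ⟨2 * C * (|K₂| + |K₃| + K * R), fun ε h0 h1 φ hsol N h hN hh n hn => ?_⟩
  subst hh
  have hN' : (0 : ℝ) < N := by exact_mod_cast hN
  have hg : WKB.grid N n ∈ Set.Icc (0 : ℝ) 1 := by
    refine ⟨by unfold WKB.grid; positivity, ?_⟩
    unfold WKB.grid
    rw [div_le_one hN']
    exact_mod_cast hn
  have hb : ‖WKB.exactZ a ε φ (WKB.grid N n)‖ ≤ R :=
    WKB.norm_fin_two_le (hZ ε h0 h1 φ hsol _ hg).1 (hZ ε h0 h1 φ hsol _ hg).2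
  have hphi := hφ ε h0 h1 N hN n hn
  set hγ' : ℝ := (1 / (N : ℝ)) ^ γ
  have hγ0 : 0 ≤ hγ' := by positivity
  -- Treats both schemes at once: `κ` stands for `K₂` or `K₃`, `E` for the corresponding power of ε
  -- and h.
  have key : ∀ (Z : Fin 2 → ℂ) (κ E : ℝ), 0 ≤ E → |κ| ≤ |K₂| + |K₃| →
      ‖Z - WKB.exactZ a ε φ (WKB.grid N n)‖ ≤ κ * E →
      ν (Z - WKB.exactZ a ε φ (WKB.grid N n)) ≤ 2 * C * (|K₂| + |K₃| + K * R) * E ∧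
      ν (WKB.backU ε (WKB.phaseApprox I a ε N n) Z - WKB.exactU a ε φ (WKB.grid N n)) ≤
        2 * C * (|K₂| + |K₃| + K * R) * hγ' / ε + 2 * C * (|K₂| + |K₃| + K * R) * E := by
    intro Z κ E hE hκ hZ
    have e1 : ‖Z - WKB.exactZ a ε φ (WKB.grid N n)‖ ≤ (|K₂| + |K₃| + K * R) * E :=
      hZ.trans (mul_le_mul_of_nonneg_right
        (((le_abs_self κ).trans hκ).trans (le_add_of_nonneg_right (by positivity))) hE)
    have e2 : |WKB.phaseApprox I a ε N n - WKB.phase a ε (WKB.grid N n)| / ε *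
        ‖WKB.exactZ a ε φ (WKB.grid N n)‖ ≤ (|K₂| + |K₃| + K * R) * hγ' / ε := by
      calc _ ≤ K * hγ' / ε * R := by gcongr
        _ = K * R * hγ' / ε := by ring
        _ ≤ _ := by
          gcongr
          exact le_add_of_nonneg_left (by positivity)
    constructor
    · calc _ ≤ C * ((|K₂| + |K₃| + K * R) * E) := (hν' _).trans (by gcongr)
        _ ≤ 2 * (C * ((|K₂| + |K₃| + K * R) * E)) := by
          have : 0 ≤ C * ((|K₂| + |K₃| + K * R) * E) := by positivity
          linarith
        _ = _ := by ring
    · calc _ ≤ C * (2 * ((|K₂| + |K₃| + K * R) * hγ' / ε)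
            + 2 * ((|K₂| + |K₃| + K * R) * E)) :=
          (hν' _).trans (mul_le_mul_of_nonneg_left
            ((WKB.norm_backU_sub_exactU_le h0 _ _ _ _).trans (by gcongr)) hC)
        _ = _ := by ring
  have hmax : 0 ≤ max ε (1 / (N : ℝ)) := h0.le.trans (le_max_left _ _)
  obtain ⟨r1, r2⟩ := key _ K₂ _ (by positivity) (le_add_of_nonneg_right (abs_nonneg _))
    (h₂ ε h0 h1 φ hsol N hN n hn)
  obtain ⟨r3, r4⟩ := key _ K₃ _ (by positivity) (le_add_of_nonneg_left (abs_nonneg _))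
    (h₃ ε h0 h1 φ hsol N hN n hn)
  simp only [← mul_assoc] at r1 r2 r3 r4 ⊢
  exact ⟨r1, r2, r3, r4⟩
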